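/- **Conventions.** Manifolds are Hausdorff, second countable and without boundary. A matrix-valued $h$-form of class $C^p$ on a manifold $\mathcal M$ is an $L\times L$ matrix $\omega=(\omega^{(ij)})$ of differential $h$-forms whose coefficients in the charts of the given atlas are of class $C^p$; the set of these is $\mathrm{Mat}_L C^p\mathcal F^h(\mathcal M)$, and $\mathrm{Mat}_L C^p_c\mathcal F^h(\mathcal M)$ is the subset of those whose entries have compact support. The operations $d$, $f^*$ and $\int_{\mathcal M}$ act entrywise, and $(\lambda\wedge\mu)^{(ij)}:=\sum_r\lambda^{(ir)}\wedge\mu^{(rj)}$. Let $\mathcal M$ be an oriented $M$-dimensional manifold of class $C^k$, with $2\le k\le\infty$, let $0\le h\le M-1$ and $1\le l\le k$. For $\lambda\in \mathrm{Mat}_L C^0\mathcal F^h(\mathcal M)$ and $\mu\in \mathrm{Mat}_L C^0\mathcal F^{h+1}(\mathcal M)$ we say that $\mu$ is a *distributional exterior derivative (DED)* of $\lambda$ with respect to test forms of class $C^l$ if $$\int_{\mathcal M}\lambda\wedge d\varphi=(-1)^{h+1}\int_{\mathcal M}\mu\wedge\varphi\qquad\text{for all }\varphi\in \mathrm{Mat}_L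 C^l_c\mathcal F^{M-h-1}(\mathcal M).$$ **Proposition 3.6.** Let $\mathcal M$ be an oriented $M$-dimensional manifold of class $C^k$ with $2\le k\le\infty$, let $\mathcal N$ be a manifold of class $C^2$, let $f:\mathcal M\to\mathcal N$ be a map of class $C^1$, and let $\omega\in \mathrm{Mat}_L C^1\mathcal F^h(\mathcal N)$ with $0\le h\le M-1$. Then $f^*\omega$ has the DED in $\mathrm{Mat}_L C^0\mathcal F^{h+1}(\mathcal M)$ and it equals $f^*(d\omega)$. Precisely: $f^*\omega$ and $f^*(d\omega)$ are of class $C^0$, and for every $l$ with $1\le l\le k$ the form $f^*(d\omega)$ is a DED of $f^*\omega$ with respect to test forms of class $C^l$; moreover, for every $l\ge 1$ with $l+1\le k$ (where $\infty+1=\infty$), it is the only one. -/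

import Mathlib

open Set MeasureTheory
open scoped Manifold

noncomputable section

/-- The wedge product of two alternating forms, `∑ (sign σ) a(v_{σ 1}, …) b(v_{σ (p+1)}, …)` over
the `(p, q)`-shuffles `σ` (so that `(dx₁ ∧ dx₂)(e₁, e₂) = 1`). -/
def ContinuousAlternatingMap.wedge {V : Type*} [AddCommGroup V] [Module ℝ V] [TopologicalSpace V]
    {p q : ℕ} (a : V [⋀^Fin p]→L[ℝ] ℝ) (b : V [⋀^Fin q]→L[ℝ] ℝ) : V [⋀^Fin (p + q)]→L[ℝ] ℝ :=
  { toAlternatingMap := ((LinearMap.mul' ℝ ℝ).compAlternatingMap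
      (a.toAlternatingMap.domCoprod b.toAlternatingMap)).domDomCongr finSumFinEquiv
    cont := by
      change Continuous fun v : Fin (p + q) → V => (LinearMap.mul' ℝ ℝ)
        ((a.toAlternatingMap.domCoprod b.toAlternatingMap) fun i => v (finSumFinEquiv i))
      have hsum : ∀ w : Fin p ⊕ Fin q → V,
          (LinearMap.mul' ℝ ℝ) ((a.toAlternatingMap.domCoprod b.toAlternatingMap) w) =
            ∑ σ, (LinearMap.mul' ℝ ℝ) (AlternatingMap.domCoprod.summand a.toAlternatingMap
              b.toAlternatingMap σ w) := fun w => by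
        rw [AlternatingMap.domCoprod_apply, _root_.sum_apply, _root_.map_sum]
      simp only [hsum]
      refine continuous_finsetSum _ fun σ _ => ?_
      induction σ using Quotient.inductionOn' with
      | h σ =>
        have hterm : ∀ v : Fin (p + q) → V,
            (LinearMap.mul' ℝ ℝ) (AlternatingMap.domCoprod.summand a.toAlternatingMap
              b.toAlternatingMap (Quotient.mk'' σ) fun i => v (finSumFinEquiv i)) =
            ((Equiv.Perm.sign σ : ℤ) : ℝ) * (a (fun i => v (finSumFinEquiv (σ (Sum.inl i)))) *
              b (fun i => v (finSumFinEquiv (σ (Sum.inr i))))) := fun v => by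
          rw [AlternatingMap.domCoprod.summand_mk'', _root_.smul_apply, Units.smul_def,
            _root_.map_zsmul, zsmul_eq_mul]
          rfl
        simp only [hterm]
        exact continuous_const.mul ((a.cont.comp (by fun_prop)).mul (b.cont.comp (by fun_prop))) }

/-- A (not necessarily continuous) differential `h`-form on the `m`-dimensional manifold `M`. -/
abbrev DiffForm (m : ℕ) (M : Type*) [TopologicalSpace M] [ChartedSpace (EuclideanSpace ℝ (Fin m)) M]
    (h : ℕ) : Type _ :=
  ∀ x : M, TangentSpace (𝓡 m) x [⋀^Fin h]→L[ℝ] ℝ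

namespace DiffForm

section Basic

variable {m n : ℕ} {M : Type*} [TopologicalSpace M] [ChartedSpace (EuclideanSpace ℝ (Fin m)) M]
  {N : Type*} [TopologicalSpace N] [ChartedSpace (EuclideanSpace ℝ (Fin n)) N] {h q : ℕ}

/-- The local representation `(e⁻¹)^* ω` of `ω` in the chart `e`, a form on `e.target ⊆ ℝ^m`. Its
value at `y` on the standard basis vectors `e_{α₁}, …, e_{α_h}` is the coefficient `f_α(y)` of
`dx_α`. It is meaningful on `e.target` only. -/
def inChart (ω : DiffForm m M h) (e : OpenPartialHomeomorph M (EuclideanSpace ℝ (Fin m)))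
    (y : EuclideanSpace ℝ (Fin m)) : EuclideanSpace ℝ (Fin m) [⋀^Fin h]→L[ℝ] ℝ :=
  (ω (e.symm y)).compContinuousLinearMap (mfderiv (𝓡 m) (𝓡 m) e.symm y)

/-- `ω` is of class `C^p`: its local representations in the charts of the atlas are of class `C^p`.
On a manifold of class `C^k` with `p + 1 ≤ k`, any compatible chart may be used instead. -/
def IsClass (p : ℕ∞) (ω : DiffForm m M h) : Prop :=
  ∀ e ∈ atlas (EuclideanSpace ℝ (Fin m)) M, ContDiffOn ℝ p (ω.inChart e) e.target

/-- `ω` has compact support. -/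
def HasCompactSupp (ω : DiffForm m M h) : Prop :=
  IsCompact (closure {x | ω x ≠ 0})

/-- The exterior derivative `dω`, computed at `x` in the preferred chart at `x`. -/
def d (ω : DiffForm m M h) : DiffForm m M (h + 1) := fun x =>
  (extDeriv (ω.inChart (chartAt (EuclideanSpace ℝ (Fin m)) x))
    (chartAt (EuclideanSpace ℝ (Fin m)) x x)).compContinuousLinearMap
    (mfderiv (𝓡 m) (𝓡 m) (chartAt (EuclideanSpace ℝ (Fin m)) x) x)

/-- The wedge product of forms. -/
def wedge (ω : DiffForm m M h) (η : DiffForm m M q) : DiffForm m M (h + q) := fun x =>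
  ContinuousAlternatingMap.wedge (ω x) (η x)

/-- The pullback `f^* ω`. -/
def pullback (f : M → N) (ω : DiffForm n N h) : DiffForm m M h := fun x =>
  (ω (f x)).compContinuousLinearMap (mfderiv (𝓡 m) (𝓡 n) f x)

/-- The coefficient of `dx₁ ∧ … ∧ dx_m` in the local representation of a form of top degree. -/
def topCoeff (hh : h = m) (ω : DiffForm m M h)
    (e : OpenPartialHomeomorph M (EuclideanSpace ℝ (Fin m))) (y : EuclideanSpace ℝ (Fin m)) : ℝ :=
  ω.inChart e y fun i => EuclideanSpace.basisFun (Fin m) ℝ (Fin.cast hh i)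

end Basic

end DiffForm

/-- An orientation of the `C^k` manifold `M`, given by an oriented atlas: a family of charts of the
`C^k` structure that cover `M` and whose transition maps have positive Jacobian determinant. -/
structure OrientedAtlas (m : ℕ) (k : ℕ∞) (M : Type*) [TopologicalSpace M]
    [ChartedSpace (EuclideanSpace ℝ (Fin m)) M] where
  charts : Set (OpenPartialHomeomorph M (EuclideanSpace ℝ (Fin m)))
  mem_maximalAtlas : ∀ e ∈ charts, e ∈ IsManifold.maximalAtlas (𝓡 m) k M
  cover : ∀ x : M, ∃ e ∈ charts, x ∈ e.source
  det_pos : ∀ e ∈ charts, ∀ e' ∈ charts, ∀ y ∈ (e.symm.trans e').source,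
    0 < (fderiv ℝ (e.symm.trans e') y).det

namespace OrientedAtlas

variable {m : ℕ} {k : ℕ∞} {M : Type*} [TopologicalSpace M]
  [ChartedSpace (EuclideanSpace ℝ (Fin m)) M]

/-- An oriented chart around `x`. -/
def chart (o : OrientedAtlas m k M) (x : M) : OpenPartialHomeomorph M (EuclideanSpace ℝ (Fin m)) :=
  (o.cover x).choose

theorem chart_mem (o : OrientedAtlas m k M) (x : M) : o.chart x ∈ o.charts :=
  (o.cover x).choose_spec.1

theorem mem_chart_source (o : OrientedAtlas m k M) (x : M) : x ∈ (o.chart x).source :=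
  (o.cover x).choose_spec.2

variable [T2Space M] [SecondCountableTopology M]

theorem exists_partition (o : OrientedAtlas m k M) :
    ∃ ρ : PartitionOfUnity M M univ, ρ.IsSubordinate fun x => (o.chart x).source := by
  have : LocallyCompactSpace M := ChartedSpace.locallyCompactSpace (EuclideanSpace ℝ (Fin m)) M
  exact PartitionOfUnity.exists_isSubordinate isClosed_univ _ (fun x => (o.chart x).open_source)
    fun x _ => mem_iUnion.2 ⟨x, o.mem_chart_source x⟩

/-- A partition of unity subordinate to oriented charts. -/
def partition (o : OrientedAtlas m k M) : PartitionOfUnity M M univ :=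
  o.exists_partition.choose

theorem partition_isSubordinate (o : OrientedAtlas m k M) :
    o.partition.IsSubordinate fun x => (o.chart x).source :=
  o.exists_partition.choose_spec

/-- The integral `∫_M τ` of a form of top degree over the oriented manifold `M`, for `τ` continuous
with compact support: `∑ i, ∫ (e_i⁻¹)^* (ρ_i τ)` with `(ρ_i)` a partition of unity subordinate to
oriented charts `(e_i)`. (The value does not depend on these choices.) -/
def integral (o : OrientedAtlas m k M) {h : ℕ} (hh : h = m) (τ : DiffForm m M h) : ℝ :=
  ∑ᶠ i : M, ∫ y in (o.chart i).target,
    o.partition i ((o.chart i).symm y) * τ.topCoeff hh (o.chart i) y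

end OrientedAtlas

/-- `L × L` matrices of differential `h`-forms on `M`. -/
abbrev MatForm (m : ℕ) (M : Type*) [TopologicalSpace M] [ChartedSpace (EuclideanSpace ℝ (Fin m)) M]
    (L h : ℕ) : Type _ :=
  Matrix (Fin L) (Fin L) (DiffForm m M h)

namespace MatForm

variable {m n : ℕ} {M : Type*} [TopologicalSpace M] [ChartedSpace (EuclideanSpace ℝ (Fin m)) M]
  {N : Type*} [TopologicalSpace N] [ChartedSpace (EuclideanSpace ℝ (Fin n)) N] {L h q : ℕ}

/-- All entries are of class `C^p`. -/
def IsClass (p : ℕ∞) (ω : MatForm m M L h) : Prop := ∀ i j, (ω i j).IsClass p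

/-- All entries have compact support. -/
def HasCompactSupp (ω : MatForm m M L h) : Prop := ∀ i j, (ω i j).HasCompactSupp

/-- Entrywise exterior derivative. -/
def d (ω : MatForm m M L h) : MatForm m M L (h + 1) := fun i j => (ω i j).d

/-- Entrywise pullback. -/
def pullback (f : M → N) (ω : MatForm n N L h) : MatForm m M L h :=
  fun i j => DiffForm.pullback f (ω i j)

/-- The exterior product, `(λ ∧ μ)^{(ij)} = ∑_r λ^{(ir)} ∧ μ^{(rj)}`. -/
def wedge (ω : MatForm m M L h) (η : MatForm m M L q) : MatForm m M L (h + q) :=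
  fun i j x => ∑ r, (ω i r).wedge (η r j) x

variable [T2Space M] [SecondCountableTopology M]

/-- Entrywise integral. -/
def integral {k : ℕ∞} (o : OrientedAtlas m k M) (hh : h = m) (ω : MatForm m M L h) :
    Matrix (Fin L) (Fin L) ℝ :=
  fun i j => o.integral hh (ω i j)

/-- The continuous `(h+1)`-form `μ` is a distributional exterior derivative of the continuous
`h`-form `lam`: `∫_M lam ∧ dφ = (-1)^{h+1} ∫_M μ ∧ φ` for all compactly supported test forms `φ` of
class `C^l` and degree `m - h - 1`. -/
structure IsDED {k : ℕ∞} (o : OrientedAtlas m k M) (l : ℕ∞) (lam : MatForm m M L h)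
    (μ : MatForm m M L (h + 1)) : Prop where
  continuous_left : lam.IsClass 0
  continuous_right : μ.IsClass 0
  integral_eq : ∀ (q : ℕ) (hq : h + q + 1 = m) (φ : MatForm m M L q),
    φ.IsClass l → φ.HasCompactSupp →
      integral o (by omega) (lam.wedge φ.d) =
        (-1 : ℝ) ^ (h + 1) • integral o (by omega) (μ.wedge φ)

end MatForm

end

/-! For `f` of class `C²` one has `d (f^* ω) = f^* (dω)` pointwise, and the claim is Stokes' theorem
in the form of integration by parts. For `f` only `C¹` the form `f^* ω` is merely continuous and
cannot be differentiated. However, both integrals in the identity contain `f` and its first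
derivative only, so they are continuous under `C¹`-uniform convergence of `f`. In coordinates one
therefore mollifies the map, applies the classical identity to each approximation and passes to the
limit: `integral_pullback_wedge_extDeriv`. The classical identity,
`integral_wedge_extDeriv_of_contDiff`, comes from writing both wedge products as sums over all
permutations and integrating by parts term by term; the sign `(-1)^(h+1)` combines a cycle of sign
`(-1)^h` with the minus sign of the partial integration.

To globalise, a test form supported in an oriented chart whose support is mapped by `f` into a chart
of `N` is treated by cutting off all coordinate data to compactly supported objects on vector
spaces. There the integral over `M` is the integral in that single chart
(`OrientedAtlas.integral_eq_setIntegral_chart`, resting on the change of variables formula with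
positive Jacobians). A general test form is split by finitely many cutoffs. The matrix statement
follows by summing over entries.

For uniqueness, a continuous form is recovered from its integrals against forms "bump times constant
form" supported in one chart, because the wedge pairing into top degree is nondegenerate.
Transplanting such a form to `M` brings in the Jacobian of a transition map and costs one
derivative, whence `l + 1 ≤ k`. Test matrices with one nonzero entry isolate the entries. -/

noncomputable section

/-! ### Antisymmetrised sums over permutations -/

/-- The sum of `sign σ * T (v ∘ σ)` over all permutations `σ`. -/
def signedSum {ι V : Type*} [Fintype ι] [DecidableEq ι] (T : (ι → V) → ℝ) (v : ι → V) : ℝ :=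
  ∑ σ : Equiv.Perm ι, ((Equiv.Perm.sign σ : ℤ) : ℝ) * T (v ∘ σ)

section SignedSum

variable {ι κ V : Type*} [Fintype ι] [DecidableEq ι] [Fintype κ] [DecidableEq κ]

theorem sign_mul_sign_self (π : Equiv.Perm ι) :
    ((Equiv.Perm.sign π : ℤ) : ℝ) * ((Equiv.Perm.sign π : ℤ) : ℝ) = 1 := by
  norm_cast
  simp

/-- Substitute `σ ↦ σ * π` in the sum. Every rearrangement of arguments below becomes a scalar sign
in this way. -/
theorem signedSum_comp_perm (T : (ι → V) → ℝ) (π : Equiv.Perm ι) (v : ι → V) :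
    signedSum (fun w => T (w ∘ π)) v = ((Equiv.Perm.sign π : ℤ) : ℝ) * signedSum T v := by
  unfold signedSum
  rw [Finset.mul_sum, ← Equiv.sum_comp (Equiv.mulRight π) (fun σ => _ * (_ * T (v ∘ σ)))]
  refine Finset.sum_congr rfl fun σ _ => ?_
  simp only [Equiv.coe_mulRight, Equiv.Perm.sign_mul, Equiv.Perm.coe_mul, Function.comp_assoc]
  push_cast
  linear_combination -((Equiv.Perm.sign σ : ℤ) : ℝ) * T (v ∘ σ ∘ π) * sign_mul_sign_self π

theorem signedSum_equiv (e : ι ≃ κ) (T : (κ → V) → ℝ) (v : κ → V) :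
    signedSum (fun w : ι → V => T (w ∘ e.symm)) (v ∘ e) = signedSum T v := by
  unfold signedSum
  rw [← Equiv.sum_comp e.permCongr]
  refine Finset.sum_congr rfl fun σ _ => ?_
  rw [Equiv.Perm.sign_permCongr]
  rfl

theorem signedSum_sum {α : Type*} (s : Finset α) (T : α → (ι → V) → ℝ) (v : ι → V) :
    signedSum (fun w => ∑ a ∈ s, T a w) v = ∑ a ∈ s, signedSum (T a) v := by
  unfold signedSum
  rw [Finset.sum_comm]
  simp only [Finset.mul_sum]

theorem signedSum_const_mul (c : ℝ) (T : (ι → V) → ℝ) (v : ι → V) :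
    signedSum (fun w => c * T w) v = c * signedSum T v := by
  unfold signedSum
  rw [Finset.mul_sum]
  exact Finset.sum_congr rfl fun _ _ => by ring

end SignedSum

/-! ### Algebra of the wedge product -/

namespace ContinuousAlternatingMap

section Wedge

variable {V W : Type*} [AddCommGroup V] [Module ℝ V] [TopologicalSpace V]
  [AddCommGroup W] [Module ℝ W] [TopologicalSpace W] {p q m : ℕ}

/-- Each shuffle class contains `p! q!` permutations with equal contributions. The sum over the full
group is easier to reindex than the one over the quotient. -/
theorem wedge_apply (a : V [⋀^Fin p]→L[ℝ] ℝ) (b : V [⋀^Fin q]→L[ℝ] ℝ) (v : Fin (p + q) → V) :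
    a.wedge b v = ((p.factorial * q.factorial : ℕ) : ℝ)⁻¹ *
      signedSum (fun w => a (fun i => w (Fin.castAdd q i)) * b (fun j => w (Fin.natAdd p j))) v := by
  have h := congrArg (fun T => (LinearMap.mul' ℝ ℝ) (T (v ∘ finSumFinEquiv)))
    (MultilinearMap.domCoprod_alternization_eq a.toAlternatingMap b.toAlternatingMap)
  rw [eq_inv_mul_iff_mul_eq₀ (by positivity), ← signedSum_equiv finSumFinEquiv]
  simp only [MultilinearMap.alternatization_apply, Fintype.card_fin, _root_.map_sum] at h
  have h2 : a.wedge b v = (LinearMap.mul' ℝ ℝ)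
      ((a.toAlternatingMap.domCoprod b.toAlternatingMap) (v ∘ finSumFinEquiv)) := rfl
  rw [h2]
  refine Eq.trans ?_ (h.symm.trans ?_)
  · rw [AlternatingMap.smul_apply, _root_.map_nsmul, nsmul_eq_mul]
  · refine Finset.sum_congr rfl fun σ _ => ?_
    rw [Units.smul_def, _root_.map_zsmul, zsmul_eq_mul]
    congr 1
    simp [MultilinearMap.domDomCongr_apply, MultilinearMap.domCoprod_apply, Function.comp_def]

/-- Degrees such as `p + 1 + q` and `p + (q + 1)` are not definitionally equal; indexing by a common
`Fin m` makes the two sides of the integration by parts comparable. -/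
theorem wedge_apply_cast (hm : p + q = m) (a : V [⋀^Fin p]→L[ℝ] ℝ) (b : V [⋀^Fin q]→L[ℝ] ℝ)
    (v : Fin m → V) :
    a.wedge b (fun i => v (Fin.cast hm i)) = ((p.factorial * q.factorial : ℕ) : ℝ)⁻¹ *
      signedSum (fun w : Fin m → V => a (fun i => w ⟨i, by omega⟩) *
        b (fun j => w ⟨p + j, by omega⟩)) v := by
  subst hm
  exact wedge_apply a b v

theorem wedge_compContinuousLinearMap (a : V [⋀^Fin p]→L[ℝ] ℝ) (b : V [⋀^Fin q]→L[ℝ] ℝ)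
    (f : W →L[ℝ] V) :
    (a.wedge b).compContinuousLinearMap f =
      (a.compContinuousLinearMap f).wedge (b.compContinuousLinearMap f) := by
  ext v
  simp only [compContinuousLinearMap_apply, wedge_apply]
  rfl

theorem wedge_add (a : V [⋀^Fin p]→L[ℝ] ℝ) (b c : V [⋀^Fin q]→L[ℝ] ℝ) :
    a.wedge (b + c) = a.wedge b + a.wedge c := by
  ext v
  simp only [wedge_apply, add_apply, mul_add, signedSum, Finset.sum_add_distrib]

theorem add_wedge (a b : V [⋀^Fin p]→L[ℝ] ℝ) (c : V [⋀^Fin q]→L[ℝ] ℝ) :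
    (a + b).wedge c = a.wedge c + b.wedge c := by
  ext v
  simp only [wedge_apply, add_apply, add_mul, mul_add, signedSum, Finset.sum_add_distrib]

theorem wedge_smul (r : ℝ) (a : V [⋀^Fin p]→L[ℝ] ℝ) (b : V [⋀^Fin q]→L[ℝ] ℝ) :
    a.wedge (r • b) = r • a.wedge b := by
  ext v
  simp only [wedge_apply, smul_apply, signedSum, smul_eq_mul, Finset.mul_sum]
  exact Finset.sum_congr rfl fun _ _ => by ring

theorem smul_wedge (r : ℝ) (a : V [⋀^Fin p]→L[ℝ] ℝ) (b : V [⋀^Fin q]→L[ℝ] ℝ) :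
    (r • a).wedge b = r • a.wedge b := by
  ext v
  simp only [wedge_apply, smul_apply, signedSum, smul_eq_mul, Finset.mul_sum]
  exact Finset.sum_congr rfl fun _ _ => by ring

@[simp] theorem wedge_zero (a : V [⋀^Fin p]→L[ℝ] ℝ) : a.wedge (0 : V [⋀^Fin q]→L[ℝ] ℝ) = 0 := by
  simpa using wedge_smul 0 a (0 : V [⋀^Fin q]→L[ℝ] ℝ)

@[simp] theorem zero_wedge (b : V [⋀^Fin q]→L[ℝ] ℝ) : (0 : V [⋀^Fin p]→L[ℝ] ℝ).wedge b = 0 := by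
  simpa using smul_wedge 0 (0 : V [⋀^Fin p]→L[ℝ] ℝ) b

end Wedge

section Alternatize

variable {V : Type*} [NormedAddCommGroup V] [NormedSpace ℝ V] {p q m : ℕ}

/-- The `p + 1` terms of the inner alternatization are cyclic rearrangements of one term. The outer
sum makes them all equal, and the factor `p + 1` turns `1 / (p + 1)!` into `1 / p!`. -/
theorem alternatizeUncurryFin_wedge_apply (hm : p + 1 + q = m) (A : V →L[ℝ] V [⋀^Fin p]→L[ℝ] ℝ)
    (b : V [⋀^Fin q]→L[ℝ] ℝ) (v : Fin m → V) :
    (alternatizeUncurryFin A).wedge b (fun i => v (Fin.cast hm i)) =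
      ((p.factorial * q.factorial : ℕ) : ℝ)⁻¹ * signedSum (fun w : Fin m → V =>
        A (w ⟨0, by omega⟩) (fun i => w ⟨i + 1, by omega⟩) * b (fun j => w ⟨p + 1 + j, by omega⟩))
        v := by
  rw [wedge_apply_cast]
  subst hm
  set T : (Fin (p + 1 + q) → V) → ℝ := fun w =>
    A (w ⟨0, by omega⟩) (fun i => w ⟨i + 1, by omega⟩) * b (fun j => w ⟨p + 1 + j, by omega⟩) with hT
  -- `π i` sends slot `0` to slot `i`, keeps the order of the other slots of `A`, and fixes the
  -- slots of `b`.
  let π : Fin (p + 1) → Equiv.Perm (Fin (p + 1 + q)) := fun i =>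
    finSumFinEquiv.permCongr (Equiv.sumCongr (Fin.cycleRange i).symm (Equiv.refl _))
  have hl : ∀ i (j : Fin (p + 1)), π i (Fin.castAdd q j) = Fin.castAdd q ((Fin.cycleRange i).symm j) :=
    fun i j => by simp [π, Equiv.permCongr_apply]
  have hr : ∀ i (j : Fin q), π i (Fin.natAdd (p + 1) j) = Fin.natAdd (p + 1) j :=
    fun i j => by simp [π, Equiv.permCongr_apply]
  have hsign : ∀ i, ((Equiv.Perm.sign (π i) : ℤ) : ℝ) = (-1) ^ (i : ℕ) := fun i => by
    simp only [π, Equiv.Perm.sign_permCongr]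
    rw [show (Equiv.sumCongr (Fin.cycleRange i).symm (Equiv.refl (Fin q))) =
      Equiv.Perm.sumCongr (Fin.cycleRange i).symm 1 from rfl, Equiv.Perm.sign_sumCongr]
    simp [Equiv.Perm.sign_symm, Fin.sign_cycleRange]
  have key : ∀ w : Fin (p + 1 + q) → V, alternatizeUncurryFin A (fun i => w ⟨i, by omega⟩) *
      b (fun j => w ⟨p + 1 + j, by omega⟩) = ∑ i : Fin (p + 1), (-1) ^ (i : ℕ) * T (w ∘ π i) := by
    intro w
    rw [alternatizeUncurryFin_apply, Finset.sum_mul]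
    refine Finset.sum_congr rfl fun i _ => ?_
    have h0 : (w ∘ π i) ⟨0, by omega⟩ = w ⟨i, by omega⟩ := by
      have := hl i 0
      rw [Fin.cycleRange_symm_zero] at this
      exact congrArg w this
    have h1 : (fun j : Fin p => (w ∘ π i) ⟨j + 1, by omega⟩) =
        i.removeNth fun i : Fin (p + 1) => w ⟨i, by omega⟩ := by
      funext j
      have := hl i j.succ
      rw [Fin.cycleRange_symm_succ] at this
      exact congrArg w this
    have h2 : (fun j : Fin q => (w ∘ π i) ⟨p + 1 + j, by omega⟩) =
        fun j : Fin q => w ⟨p + 1 + j, by omega⟩ := by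
      funext j
      exact congrArg w (hr i j)
    simp only [hT, h0, h1, h2]
    ring
  simp only [key]
  rw [signedSum_sum]
  -- The sign in the alternatization meets the sign of the cycle: `(-1)^(i + i) = 1`.
  simp only [signedSum_const_mul, signedSum_comp_perm, hsign, ← mul_assoc, ← pow_add]
  simp only [Even.neg_pow (Even.add_self _), one_pow, one_mul, Finset.sum_const, Finset.card_univ,
    Fintype.card_fin, nsmul_eq_mul, Nat.factorial_succ]
  push_cast
  have : (p.factorial : ℝ) ≠ 0 := by positivity
  have : (q.factorial : ℝ) ≠ 0 := by positivity
  field_simp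

/-- The same argument on the last `q + 1` slots. The prefactor is again `1 / (p! q!)`, but the
differentiation direction now sits in slot `p` instead of slot `0`. -/
theorem wedge_alternatizeUncurryFin_apply (hm : p + (q + 1) = m) (a : V [⋀^Fin p]→L[ℝ] ℝ)
    (B : V →L[ℝ] V [⋀^Fin q]→L[ℝ] ℝ) (v : Fin m → V) :
    a.wedge (alternatizeUncurryFin B) (fun i => v (Fin.cast hm i)) =
      ((p.factorial * q.factorial : ℕ) : ℝ)⁻¹ * signedSum (fun w : Fin m → V =>
        a (fun i => w ⟨i, by omega⟩) * B (w ⟨p, by omega⟩) (fun j => w ⟨p + 1 + j, by omega⟩))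
        v := by
  rw [wedge_apply_cast]
  subst hm
  set T : (Fin (p + (q + 1)) → V) → ℝ := fun w =>
    a (fun i => w ⟨i, by omega⟩) * B (w ⟨p, by omega⟩) (fun j => w ⟨p + 1 + j, by omega⟩) with hT
  let π : Fin (q + 1) → Equiv.Perm (Fin (p + (q + 1))) := fun i =>
    finSumFinEquiv.permCongr (Equiv.sumCongr (Equiv.refl _) (Fin.cycleRange i).symm)
  have hr : ∀ i (j : Fin (q + 1)), π i (Fin.natAdd p j) = Fin.natAdd p ((Fin.cycleRange i).symm j) :=
    fun i j => by simp [π, Equiv.permCongr_apply]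
  have hl : ∀ i (j : Fin p), π i (Fin.castAdd (q + 1) j) = Fin.castAdd (q + 1) j :=
    fun i j => by simp [π, Equiv.permCongr_apply]
  have hsign : ∀ i, ((Equiv.Perm.sign (π i) : ℤ) : ℝ) = (-1) ^ (i : ℕ) := fun i => by
    simp only [π, Equiv.Perm.sign_permCongr]
    rw [show (Equiv.sumCongr (Equiv.refl (Fin p)) (Fin.cycleRange i).symm) =
      Equiv.Perm.sumCongr 1 (Fin.cycleRange i).symm from rfl, Equiv.Perm.sign_sumCongr]
    simp [Equiv.Perm.sign_symm, Fin.sign_cycleRange]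
  have key : ∀ w : Fin (p + (q + 1)) → V, a (fun i => w ⟨i, by omega⟩) *
      alternatizeUncurryFin B (fun j => w ⟨p + j, by omega⟩) =
        ∑ i : Fin (q + 1), (-1) ^ (i : ℕ) * T (w ∘ π i) := by
    intro w
    rw [alternatizeUncurryFin_apply, Finset.mul_sum]
    refine Finset.sum_congr rfl fun i _ => ?_
    have h0 : (w ∘ π i) ⟨p, by omega⟩ = w ⟨p + i, by omega⟩ := by
      have := hr i 0
      rw [Fin.cycleRange_symm_zero] at this
      exact congrArg w this
    have h1 : (fun j : Fin q => (w ∘ π i) ⟨p + 1 + j, by omega⟩) =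
        i.removeNth fun i : Fin (q + 1) => w ⟨p + i, by omega⟩ := by
      funext j
      have := hr i j.succ
      rw [Fin.cycleRange_symm_succ] at this
      have h3 : (⟨p + 1 + j, by omega⟩ : Fin (p + (q + 1))) = Fin.natAdd p j.succ := by
        ext; simp; omega
      rw [Function.comp_apply, h3]
      exact congrArg w this
    have h2 : (fun j : Fin p => (w ∘ π i) ⟨j, by omega⟩) = fun j : Fin p => w ⟨j, by omega⟩ := by
      funext j
      exact congrArg w (hl i j)
    simp only [hT, h0, h1, h2]
    ring
  simp only [key]
  rw [signedSum_sum]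
  simp only [signedSum_const_mul, signedSum_comp_perm, hsign, ← mul_assoc, ← pow_add]
  simp only [Even.neg_pow (Even.add_self _), one_pow, one_mul, Finset.sum_const, Finset.card_univ,
    Fintype.card_fin, nsmul_eq_mul, Nat.factorial_succ]
  push_cast
  have : (p.factorial : ℝ) ≠ 0 := by positivity
  have : (q.factorial : ℝ) ≠ 0 := by positivity
  field_simp

end Alternatize

end ContinuousAlternatingMap

/-! ### Regularity of pullback and wedge of alternating forms -/

namespace ContinuousAlternatingMap

section Regularity

variable {V X : Type*} [NormedAddCommGroup V] [NormedSpace ℝ V] [FiniteDimensional ℝ V]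
  [NormedAddCommGroup X] [NormedSpace ℝ X] {p q : ℕ} {n : WithTop ℕ∞} {s : Set X}

variable (V p) in
-- Evaluation on tuples of basis vectors is injective, so it has a linear left inverse,
-- automatically continuous on a finite-dimensional space. Regularity of form-valued maps thereby
-- reduces to scalar functions.
theorem exists_continuousLinearMap_apply_basis :
    ∃ G : ((Fin p → Fin (Module.finrank ℝ V)) → ℝ) →L[ℝ] V [⋀^Fin p]→L[ℝ] ℝ,
      ∀ a : V [⋀^Fin p]→L[ℝ] ℝ, G (fun r => a fun i => Module.finBasis ℝ V (r i)) = a := by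
  let ev : (V [⋀^Fin p]→L[ℝ] ℝ) →ₗ[ℝ] ((Fin p → Fin (Module.finrank ℝ V)) → ℝ) :=
    { toFun := fun a r => a fun i => Module.finBasis ℝ V (r i)
      map_add' := fun _ _ => rfl
      map_smul' := fun _ _ => rfl }
  have hinj : LinearMap.ker ev = ⊥ := by
    rw [LinearMap.ker_eq_bot]
    intro a b hab
    apply ContinuousAlternatingMap.toAlternatingMap_injective
    refine Module.Basis.ext_alternating (Module.finBasis ℝ V) fun r _ => ?_
    exact congrFun hab r
  obtain ⟨G, hG⟩ := LinearMap.exists_leftInverse_of_injective ev hinj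
  exact ⟨LinearMap.toContinuousLinearMap G, fun a => LinearMap.congr_fun hG a⟩

theorem contDiffOn_of_apply {f : X → V [⋀^Fin p]→L[ℝ] ℝ}
    (h : ∀ v, ContDiffOn ℝ n (fun x => f x v) s) : ContDiffOn ℝ n f s := by
  obtain ⟨G, hG⟩ := exists_continuousLinearMap_apply_basis V p
  have : f = fun x => G (fun r => f x fun i => Module.finBasis ℝ V (r i)) := by
    funext x
    exact (hG _).symm
  rw [this]
  exact G.contDiff.comp_contDiffOn (contDiffOn_pi.2 fun r => h _)

omit [FiniteDimensional ℝ V] in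
theorem contDiffOn_apply_const {f : X → V [⋀^Fin p]→L[ℝ] ℝ} (h : ContDiffOn ℝ n f s)
    (v : Fin p → V) : ContDiffOn ℝ n (fun x => f x v) s :=
  (ContinuousAlternatingMap.apply ℝ V ℝ v).contDiff.comp_contDiffOn h

/-- By multilinearity the value is a polynomial in the coordinates of the arguments, with
coefficients `f x (b r)`. -/
theorem contDiffOn_apply {f : X → V [⋀^Fin p]→L[ℝ] ℝ} (h : ContDiffOn ℝ n f s)
    {w : Fin p → X → V} (hw : ∀ i, ContDiffOn ℝ n (w i) s) :
    ContDiffOn ℝ n (fun x => f x fun i => w i x) s := by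
  let b := Module.finBasis ℝ V
  have : (fun x => f x fun i => w i x) = fun x => ∑ r : Fin p → Fin (Module.finrank ℝ V),
      (∏ i, b.repr (w i x) (r i)) * f x fun i => b (r i) := by
    funext x
    conv_lhs => rw [show (fun i => w i x) = fun i => ∑ k, b.repr (w i x) k • b k from
      funext fun i => (b.sum_repr _).symm]
    refine ((f x).toMultilinearMap.map_sum (fun i k => b.repr (w i x) k • b k)).trans ?_
    refine Finset.sum_congr rfl fun r _ => ?_
    exact (f x).toMultilinearMap.map_smul_univ _ _
  rw [this]
  refine ContDiffOn.sum fun r _ => ContDiffOn.mul ?_ (contDiffOn_apply_const h _)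
  refine contDiffOn_prod fun i _ => ?_
  exact (LinearMap.toContinuousLinearMap (b.coord (r i))).contDiff.comp_contDiffOn (hw i)

variable {W : Type*} [NormedAddCommGroup W] [NormedSpace ℝ W] [FiniteDimensional ℝ W]

theorem contDiffOn_compContinuousLinearMap {f : X → V [⋀^Fin p]→L[ℝ] ℝ} {A : X → W →L[ℝ] V}
    (hf : ContDiffOn ℝ n f s) (hA : ContDiffOn ℝ n A s) :
    ContDiffOn ℝ n (fun x => (f x).compContinuousLinearMap (A x)) s :=
  contDiffOn_of_apply fun v => contDiffOn_apply hf fun i => hA.clm_apply (contDiffOn_const (c := v i))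

theorem contDiffOn_wedge {f : X → V [⋀^Fin p]→L[ℝ] ℝ} {g : X → V [⋀^Fin q]→L[ℝ] ℝ}
    (hf : ContDiffOn ℝ n f s) (hg : ContDiffOn ℝ n g s) :
    ContDiffOn ℝ n (fun x => (f x).wedge (g x)) s := by
  refine contDiffOn_of_apply fun v => ?_
  simp only [wedge_apply, signedSum]
  exact contDiffOn_const.mul (ContDiffOn.sum fun σ _ => contDiffOn_const.mul
    ((contDiffOn_apply_const hf _).mul (contDiffOn_apply_const hg _)))

/-- Here `X` is only a topological space: the universal map on the product of the two parameter
spaces is continuous, being `C⁰` by the previous results, and is then composed. -/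
theorem continuousOn_compContinuousLinearMap {X : Type*} [TopologicalSpace X] {s : Set X}
    {f : X → V [⋀^Fin p]→L[ℝ] ℝ} {A : X → W →L[ℝ] V}
    (hf : ContinuousOn f s) (hA : ContinuousOn A s) :
    ContinuousOn (fun x => (f x).compContinuousLinearMap (A x)) s := by
  have h := contDiffOn_compContinuousLinearMap (n := 0) (s := univ)
    (f := fun z : (V [⋀^Fin p]→L[ℝ] ℝ) × (W →L[ℝ] V) => z.1) (A := fun z => z.2)
    contDiff_fst.contDiffOn contDiff_snd.contDiffOn
  rw [contDiffOn_zero, continuousOn_univ] at h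
  exact h.comp_continuousOn (hf.prodMk hA)

theorem continuous_wedge_uncurry : Continuous
    fun z : (V [⋀^Fin p]→L[ℝ] ℝ) × (V [⋀^Fin q]→L[ℝ] ℝ) => z.1.wedge z.2 := by
  have h : ContDiffOn ℝ 0 (fun z : (V [⋀^Fin p]→L[ℝ] ℝ) × (V [⋀^Fin q]→L[ℝ] ℝ) =>
      z.1.wedge z.2) univ :=
    contDiffOn_wedge contDiff_fst.contDiffOn contDiff_snd.contDiffOn
  exact continuousOn_univ.1 h.continuousOn

theorem continuousOn_wedge {X : Type*} [TopologicalSpace X] {s : Set X}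
    {f : X → V [⋀^Fin p]→L[ℝ] ℝ} {g : X → V [⋀^Fin q]→L[ℝ] ℝ}
    (hf : ContinuousOn f s) (hg : ContinuousOn g s) :
    ContinuousOn (fun x => (f x).wedge (g x)) s := by
  have h := continuous_wedge_uncurry (V := V) (p := p) (q := q)
  have h2 := h.comp_continuousOn (hf.prodMk hg)
  exact h2

end Regularity

/-! ### Nondegeneracy of the wedge pairing into top degree -/

section Nondegenerate

variable {m p q : ℕ}

theorem exists_equiv_extending_injective (hm : p + q = m) {v : Fin p → Fin m}
    (hv : Function.Injective v) : ∃ σ : Fin p ⊕ Fin q ≃ Fin m, ∀ i, σ (Sum.inl i) = v i := by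
  classical
  have hc : Fintype.card (Fin q) = Fintype.card ((range v)ᶜ : Set (Fin m)) := by
    rw [Fintype.card_compl_set, Set.card_range_of_injective hv]
    simp
    omega
  exact ⟨(Equiv.sumCongr (Equiv.ofInjective v hv) (Fintype.equivOfCardEq hc)).trans
    (Equiv.Set.sumCompl (range v)), fun i => by simp⟩

/-- To see that `a` vanishes on distinct basis vectors `E (v i)`, pair it with the alternatization
of the product of the complementary coordinates. All surviving terms of the permutation sum are the
same signed multiple of `a (E ∘ v)`, so they cannot cancel. -/
theorem eq_zero_of_forall_wedge_apply_basis_eq_zero (hm : p + q = m)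
    (a : EuclideanSpace ℝ (Fin m) [⋀^Fin p]→L[ℝ] ℝ)
    (h : ∀ b : EuclideanSpace ℝ (Fin m) [⋀^Fin q]→L[ℝ] ℝ,
      a.wedge b (fun i => EuclideanSpace.basisFun (Fin m) ℝ (Fin.cast hm i)) = 0) : a = 0 := by
  apply ContinuousAlternatingMap.toAlternatingMap_injective
  refine Module.Basis.ext_alternating (EuclideanSpace.basisFun (Fin m) ℝ).toBasis fun v hv => ?_
  obtain ⟨σ, hσ⟩ := exists_equiv_extending_injective hm hv
  set E : Fin m → EuclideanSpace ℝ (Fin m) := fun i => EuclideanSpace.basisFun (Fin m) ℝ i with hE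
  suffices hav : a (fun i => E (v i)) = 0 by simpa [hE] using hav
  let B : ContinuousMultilinearMap ℝ (fun _ : Fin q => EuclideanSpace ℝ (Fin m)) ℝ :=
    (ContinuousMultilinearMap.mkPiAlgebra ℝ (Fin q) ℝ).compContinuousLinearMap
      fun j => EuclideanSpace.proj (σ (Sum.inr j))
  have hB : ∀ w, B w = ∏ j, w j (σ (Sum.inr j)) := fun w => by simp [B]
  have hb := h B.alternatization
  rw [wedge_apply_cast hm a B.alternatization E] at hb
  have hb' := (mul_eq_zero.1 hb).resolve_left (by positivity)
  subst hm
  set T : (Fin (p + q) → EuclideanSpace ℝ (Fin (p + q))) → ℝ := fun w =>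
    a (fun i => w ⟨i, by omega⟩) * B (fun j => w ⟨p + j, by omega⟩) with hT
  let π : Equiv.Perm (Fin q) → Equiv.Perm (Fin (p + q)) := fun τ =>
    finSumFinEquiv.permCongr (Equiv.sumCongr (Equiv.refl _) τ)
  have hr : ∀ i (j : Fin q), π i (Fin.natAdd p j) = Fin.natAdd p (i j) :=
    fun i j => by simp [π, Equiv.permCongr_apply]
  have hl : ∀ i (j : Fin p), π i (Fin.castAdd q j) = Fin.castAdd q j :=
    fun i j => by simp [π, Equiv.permCongr_apply]
  have hsign : ∀ τ, Equiv.Perm.sign (π τ) = Equiv.Perm.sign τ := fun τ => by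
    simp only [π, Equiv.Perm.sign_permCongr]
    rw [show (Equiv.sumCongr (Equiv.refl (Fin p)) τ) = Equiv.Perm.sumCongr 1 τ from rfl,
      Equiv.Perm.sign_sumCongr]
    simp
  have key : ∀ w : Fin (p + q) → EuclideanSpace ℝ (Fin (p + q)),
      a (fun i => w ⟨i, by omega⟩) * B.alternatization (fun j => w ⟨p + j, by omega⟩) =
        ∑ τ : Equiv.Perm (Fin q), ((Equiv.Perm.sign τ : ℤ) : ℝ) * T (w ∘ π τ) := by
    intro w
    rw [ContinuousMultilinearMap.alternatization_apply_apply, Finset.mul_sum]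
    refine Finset.sum_congr rfl fun τ _ => ?_
    have h1 : (fun i : Fin p => (w ∘ π τ) ⟨i, by omega⟩) = fun i : Fin p => w ⟨i, by omega⟩ :=
      funext fun i => congrArg w (hl τ i)
    have h2 : (fun j : Fin q => (w ∘ π τ) ⟨p + j, by omega⟩) =
        (fun j : Fin q => w ⟨p + j, by omega⟩) ∘ τ := funext fun j => congrArg w (hr τ j)
    simp only [hT, h1, h2, Units.smul_def, zsmul_eq_mul]
    ring
  -- The alternatization of `B` is absorbed by the outer sum: each `τ` contributes `sign τ * sign τ
  -- = 1`, so `B.alternatization` may be replaced by `B` up to the factor `q!`.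
  simp only [key] at hb'
  rw [signedSum_sum] at hb'
  simp only [signedSum_const_mul, signedSum_comp_perm, hsign, ← mul_assoc, sign_mul_sign_self,
    one_mul, Finset.sum_const, Finset.card_univ, nsmul_eq_mul] at hb'
  have hb2 := (mul_eq_zero.1 hb').resolve_left (by positivity)
  let ρ : Fin p ⊕ Fin q ≃ Fin (p + q) := finSumFinEquiv
  let σ' : Equiv.Perm (Fin (p + q)) := ρ.symm.trans σ
  -- `c τ` is `1` if `τ` agrees with `σ'` on the last `q` slots and `0` otherwise.
  set c : Equiv.Perm (Fin (p + q)) → ℝ := fun τ =>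
    ∏ j : Fin q, if τ (Fin.natAdd p j) = σ (Sum.inr j) then 1 else 0 with hc
  have hterm : ∀ τ : Equiv.Perm (Fin (p + q)), ((Equiv.Perm.sign τ : ℤ) : ℝ) * T (E ∘ τ) =
      (((Equiv.Perm.sign σ' : ℤ) : ℝ) * a (fun i => E (v i))) * c τ := by
    intro τ
    have hBc : B (fun j : Fin q => (E ∘ τ) ⟨p + j, by omega⟩) = c τ := by
      rw [hB]
      refine Finset.prod_congr rfl fun j _ => ?_
      simp only [Function.comp_apply, hE, EuclideanSpace.basisFun_apply]
      rw [show (⟨p + (j : ℕ), by omega⟩ : Fin (p + q)) = Fin.natAdd p j from rfl]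
      simp [eq_comm]
    simp only [hT, hBc]
    by_cases hτ : ∀ j, τ (Fin.natAdd p j) = σ (Sum.inr j)
    -- Such a `τ` differs from `σ'` by a permutation `π1` of the first block only; its sign enters
    -- once through `sign τ` and once through `a`, and cancels.
    · let π' : Equiv.Perm (Fin p ⊕ Fin q) := (ρ.trans τ).trans σ.symm
      have hπr : ∀ j, π' (Sum.inr j) = Sum.inr j := fun j => by
        simp [π', ρ, hτ]
      have hmaps : MapsTo π' (range Sum.inl) (range Sum.inl) := by
        rintro _ ⟨i, rfl⟩
        rcases hx : π' (Sum.inl i) with j | j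
        · exact ⟨j, rfl⟩
        · rw [← hπr j] at hx
          simpa using π'.injective hx
      obtain ⟨⟨π1, π2⟩, hπ⟩ := Equiv.Perm.mem_sumCongrHom_range_of_perm_mapsTo_inl hmaps
      have hπ' : π' = Equiv.Perm.sumCongr π1 π2 := hπ.symm
      have hπ2 : π2 = 1 := by
        ext1 j
        have := hπr j
        rw [hπ'] at this
        simpa using this
      have hτl : ∀ i, τ (Fin.castAdd q i) = v (π1 i) := fun i => by
        have : π' (Sum.inl i) = Sum.inl (π1 i) := by rw [hπ']; simp
        rw [← hσ, ← this]
        simp [π', ρ]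
      have hτσ : τ = (ρ.permCongr π').trans σ' := by
        ext1 i
        simp [Equiv.permCongr_apply, π', σ']
      have hs : Equiv.Perm.sign τ = Equiv.Perm.sign σ' * Equiv.Perm.sign π1 := by
        rw [hτσ, Equiv.Perm.sign_trans, Equiv.Perm.sign_permCongr, hπ', hπ2,
          Equiv.Perm.sign_sumCongr]
        simp
      have ha : a (fun i => (E ∘ τ) ⟨i, by omega⟩) =
          ((Equiv.Perm.sign π1 : ℤ) : ℝ) * a (fun i => E (v i)) := by
        have h1 : (fun i : Fin p => (E ∘ τ) ⟨i, by omega⟩) = (fun i => E (v i)) ∘ π1 :=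
          funext fun i => congrArg E (hτl i)
        rw [h1]
        refine (a.toAlternatingMap.map_perm (fun i => E (v i)) π1).trans ?_
        rw [Units.smul_def, zsmul_eq_mul]
        rfl
      rw [ha, hs]
      push_cast
      linear_combination (((Equiv.Perm.sign σ' : ℤ) : ℝ) * a (fun i => E (v i)) * c τ) *
        sign_mul_sign_self π1
    · have : c τ = 0 := by
        push Not at hτ
        obtain ⟨j, hj⟩ := hτ
        exact Finset.prod_eq_zero (Finset.mem_univ j) (if_neg hj)
      simp [this]
  unfold signedSum at hb2
  simp only [hterm] at hb2
  rw [← Finset.mul_sum] at hb2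
  have hpos : 0 < ∑ τ, c τ := by
    refine Finset.sum_pos' (fun τ _ => Finset.prod_nonneg fun j _ => by split_ifs <;> norm_num)
      ⟨σ', Finset.mem_univ _, ?_⟩
    have : c σ' = 1 := Finset.prod_eq_one fun j _ => if_pos (by simp [σ', ρ])
    rw [this]
    exact one_pos
  refine (mul_eq_zero.1 ((mul_eq_zero.1 hb2).resolve_right hpos.ne')).resolve_left ?_
  intro h0
  have := sign_mul_sign_self σ'
  rw [h0] at this
  simp at this

end Nondegenerate

end ContinuousAlternatingMap

/-! ### The identity on vector spaces: integration by parts and mollification -/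

section Core

open ContinuousAlternatingMap Filter Topology

variable {V W : Type*} [NormedAddCommGroup V] [NormedSpace ℝ V] [FiniteDimensional ℝ V]
  [MeasurableSpace V] [BorelSpace V] [NormedAddCommGroup W] [NormedSpace ℝ W]
  [FiniteDimensional ℝ W] (μ : Measure V) [μ.IsAddHaarMeasure] {p q m : ℕ}

omit [FiniteDimensional ℝ V] [MeasurableSpace V] [BorelSpace V] in
theorem continuous_extDeriv {ω : V → V [⋀^Fin p]→L[ℝ] ℝ} (hω : ContDiff ℝ 1 ω) :
    Continuous (extDeriv ω) :=
  (alternatizeUncurryFinCLM ℝ V ℝ).continuous.comp (hω.continuous_fderiv one_ne_zero)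

omit [FiniteDimensional ℝ V] [MeasurableSpace V] [BorelSpace V] in
theorem extDeriv_eq_zero_of_notMem_tsupport {ω : V → V [⋀^Fin p]→L[ℝ] ℝ} {x : V}
    (hx : x ∉ tsupport ω) : extDeriv ω x = 0 := by
  have : fderiv ℝ ω x = 0 := by
    by_contra h
    exact hx (support_fderiv_subset ℝ h)
  ext v
  simp [extDeriv, this, alternatizeUncurryFin_apply]

/-- Integration by parts for forms of class `C^1`, one of them compactly supported. -/
theorem integral_wedge_extDeriv_of_contDiff {lam : V → V [⋀^Fin p]→L[ℝ] ℝ}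
    {φ : V → V [⋀^Fin q]→L[ℝ] ℝ} (hlam : ContDiff ℝ 1 lam) (hφ : ContDiff ℝ 1 φ)
    (hc : HasCompactSupport φ) (h1 : p + (q + 1) = m) (h2 : p + 1 + q = m) (v : Fin m → V) :
    ∫ x, (lam x).wedge (extDeriv φ x) (fun i => v (Fin.cast h1 i)) ∂μ =
      (-1) ^ (p + 1) *
        ∫ x, (extDeriv lam x).wedge (φ x) (fun i => v (Fin.cast h2 i)) ∂μ := by
  have hlamd : ∀ x, DifferentiableAt ℝ lam x := fun x => hlam.differentiable one_ne_zero x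
  have hφd : ∀ x, DifferentiableAt ℝ φ x := fun x => hφ.differentiable one_ne_zero x
  have hdlam := hlam.continuous_fderiv one_ne_zero
  have hdφ := hφ.continuous_fderiv one_ne_zero
  have hcd : HasCompactSupport (fderiv ℝ φ) := hc.fderiv ℝ
  have e1 : ∀ u, Continuous fun x => lam x u := fun u =>
    (ContinuousAlternatingMap.apply ℝ V ℝ u).continuous.comp hlam.continuous
  have e2 : ∀ u, Continuous fun x => φ x u := fun u =>
    (ContinuousAlternatingMap.apply ℝ V ℝ u).continuous.comp hφ.continuous
  have e3 : ∀ d u, Continuous fun x => fderiv ℝ lam x d u := fun d u =>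
    (ContinuousAlternatingMap.apply ℝ V ℝ u).continuous.comp (hdlam.clm_apply continuous_const)
  have e4 : ∀ d u, Continuous fun x => fderiv ℝ φ x d u := fun d u =>
    (ContinuousAlternatingMap.apply ℝ V ℝ u).continuous.comp (hdφ.clm_apply continuous_const)
  have c2 : ∀ u, HasCompactSupport fun x => φ x u := fun u =>
    hc.comp_left (g := fun a : V [⋀^Fin q]→L[ℝ] ℝ => a u) rfl
  have c4 : ∀ d u, HasCompactSupport fun x => fderiv ℝ φ x d u := fun d u =>
    hcd.comp_left (g := fun a : V →L[ℝ] V [⋀^Fin q]→L[ℝ] ℝ => a d u) rfl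
  have i1 : ∀ u d u', Integrable (fun x => lam x u * fderiv ℝ φ x d u') μ := fun u d u' =>
    ((e1 u).mul (e4 d u')).integrable_of_hasCompactSupport (c4 d u').mul_left
  have i2 : ∀ d u u', Integrable (fun x => fderiv ℝ lam x d u * φ x u') μ := fun d u u' =>
    ((e3 d u).mul (e2 u')).integrable_of_hasCompactSupport (c2 u').mul_left
  have i3 : ∀ u u', Integrable (fun x => lam x u * φ x u') μ := fun u u' =>
    ((e1 u).mul (e2 u')).integrable_of_hasCompactSupport (c2 u').mul_left
  -- With the direction and all arguments frozen, this is scalar integration by parts; compact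
  -- support of `φ` gives the integrability.
  have parts : ∀ d u u', ∫ x, lam x u * fderiv ℝ φ x d u' ∂μ =
      -∫ x, fderiv ℝ lam x d u * φ x u' ∂μ := by
    intro d u u'
    have hf : ∀ x, fderiv ℝ (fun y => lam y u) x d = fderiv ℝ lam x d u := fun x =>
      fderiv_continuousAlternatingMap_apply_const_apply (hlamd x) u d
    have hg : ∀ x, fderiv ℝ (fun y => φ y u') x d = fderiv ℝ φ x d u' := fun x =>
      fderiv_continuousAlternatingMap_apply_const_apply (hφd x) u' d
    have := integral_mul_fderiv_eq_neg_fderiv_mul_of_integrable (μ := μ) (v := d)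
      (f := fun x => lam x u) (g := fun x => φ x u')
      (by simpa only [hf] using i2 d u u') (by simpa only [hg] using i1 u d u') (i3 u u')
      (fun x _ => (ContinuousAlternatingMap.apply ℝ V ℝ u).differentiableAt.comp x (hlamd x))
      (fun x _ => (ContinuousAlternatingMap.apply ℝ V ℝ u').differentiableAt.comp x (hφd x))
    simpa only [hf, hg] using this
  have hpm : p < m := by omega
  set k : Fin m := ⟨p, hpm⟩ with hk
  -- Moving the differentiation direction from slot `0` to slot `p` is a `(p + 1)`-cycle, of sign
  -- `(-1)^p`.
  have hcyc : ∀ x, signedSum (fun w : Fin m → V => fderiv ℝ lam x (w ⟨0, by omega⟩)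
      (fun i : Fin p => w ⟨i + 1, by omega⟩) * φ x (fun j : Fin q => w ⟨p + 1 + j, by omega⟩)) v =
      (-1) ^ p * signedSum (fun w : Fin m → V => fderiv ℝ lam x (w k)
        (fun i : Fin p => w ⟨i, by omega⟩) * φ x (fun j : Fin q => w ⟨p + 1 + j, by omega⟩)) v := by
    intro x
    have hs : ((Equiv.Perm.sign k.cycleRange : ℤ) : ℝ) = (-1) ^ p := by
      simp [Fin.sign_cycleRange, hk]
    rw [← hs, ← signedSum_comp_perm]
    congr 1
    funext w
    have : NeZero m := ⟨by omega⟩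
    have a1 : (w ∘ k.cycleRange) k = w ⟨0, by omega⟩ := by
      simp only [Function.comp_apply, Fin.cycleRange_self]
      rfl
    have a2 : (fun i : Fin p => (w ∘ k.cycleRange) ⟨i, by omega⟩) =
        fun i : Fin p => w ⟨i + 1, by omega⟩ := by
      funext i
      refine congrArg w (Fin.ext ?_)
      exact Fin.coe_cycleRange_of_lt (show (⟨i, by omega⟩ : Fin m) < k from i.2)
    have a3 : (fun j : Fin q => (w ∘ k.cycleRange) ⟨p + 1 + j, by omega⟩) =
        fun j : Fin q => w ⟨p + 1 + j, by omega⟩ := by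
      funext j
      refine congrArg w (Fin.cycleRange_of_gt ?_)
      rw [Fin.lt_def]
      simp only [hk]
      omega
    simp only [a1, a2, a3]
  simp only [extDeriv, wedge_alternatizeUncurryFin_apply, alternatizeUncurryFin_wedge_apply, hcyc]
  rw [integral_const_mul, integral_const_mul, integral_const_mul]
  unfold signedSum
  rw [integral_finsetSum _ fun σ _ => (i1 _ _ _).const_mul _,
    integral_finsetSum _ fun σ _ => (i2 _ _ _).const_mul _]
  simp only [integral_const_mul, parts, hk]
  push_cast
  simp only [mul_neg, Finset.sum_neg_distrib, pow_succ]
  have : ((-1 : ℝ) ^ p) * (-1) ^ p = 1 := by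
    rw [← mul_pow]
    simp
  linear_combination (((p.factorial : ℝ) * (q.factorial : ℝ))⁻¹ *
    ∑ σ : Equiv.Perm (Fin m), ((Equiv.Perm.sign σ : ℤ) : ℝ) *
      ∫ x, fderiv ℝ lam x ((v ∘ σ) k) (fun i : Fin p => (v ∘ σ) ⟨i, by omega⟩) *
        φ x (fun j : Fin q => (v ∘ σ) ⟨p + 1 + j, by omega⟩) ∂μ) * this

/-- A sequence of bump functions with radii tending to `0`. -/
def shrinkingBump (V : Type*) [NormedAddCommGroup V] [NormedSpace ℝ V] (j : ℕ) :
    ContDiffBump (0 : V) :=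
  ⟨1 / (2 * ((j : ℝ) + 1)), 1 / ((j : ℝ) + 1), by positivity, by
    apply one_div_lt_one_div_of_lt <;> linarith [(Nat.cast_nonneg j : (0 : ℝ) ≤ j)]⟩

/-- Compact support makes `f` uniformly continuous, so averaging over a ball of radius `1 / (j + 1)`
moves all values by little, uniformly in the centre. -/
theorem tendstoUniformly_convolution_shrinkingBump {f : V → W} (hf : Continuous f)
    (hfc : HasCompactSupport f) :
    TendstoUniformly (fun j => convolution ((shrinkingBump V j).normed μ) f
      (ContinuousLinearMap.lsmul ℝ ℝ) μ) f atTop := by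
  have huc := hfc.uniformContinuous_of_continuous hf
  rw [Metric.tendstoUniformly_iff]
  intro ε hε
  obtain ⟨δ, hδ, hd⟩ := Metric.uniformContinuous_iff.1 huc (ε / 2) (half_pos hε)
  filter_upwards [(tendsto_one_div_add_atTop_nhds_zero_nat (𝕜 := ℝ)).eventually
    (gt_mem_nhds hδ)] with j hj x
  have : CompleteSpace W := FiniteDimensional.complete ℝ W
  have := ContDiffBump.dist_normed_convolution_le (φ := shrinkingBump V j) (μ := μ) (x₀ := x)
    (ε := ε / 2) (g := f) hf.aestronglyMeasurable fun y hy => (hd (lt_trans hy hj)).le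
  rw [dist_comm]
  linarith

/-- Mollification: a compactly supported `C^1` map is a `C^1`-uniform limit of smooth maps. -/
theorem exists_contDiff_tendstoUniformly {g : V → W} (hg : ContDiff ℝ 1 g)
    (hc : HasCompactSupport g) :
    ∃ G : ℕ → V → W, (∀ j, ContDiff ℝ 2 (G j)) ∧ TendstoUniformly G g atTop ∧
      TendstoUniformly (fun j => fderiv ℝ (G j)) (fderiv ℝ g) atTop := by
  let μ : Measure V := Measure.addHaar
  refine ⟨fun j => convolution ((shrinkingBump V j).normed μ) g (ContinuousLinearMap.lsmul ℝ ℝ) μ,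
    fun j => ?_, tendstoUniformly_convolution_shrinkingBump μ hg.continuous hc, ?_⟩
  · have := (shrinkingBump V j).hasCompactSupport_normed (μ := μ) |>.contDiff_convolution_left
      (ContinuousLinearMap.lsmul ℝ ℝ : ℝ →L[ℝ] W →L[ℝ] W)
      ((shrinkingBump V j).contDiff_normed (n := 2))
      (hg.continuous.locallyIntegrable (μ := μ))
    exact_mod_cast this
  -- Differentiation falls on `g`, so the derivatives are mollifications of `fderiv ℝ g` and
  -- converge by the same lemma.
  · have hd : ∀ j, fderiv ℝ (convolution ((shrinkingBump V j).normed μ) g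
          (ContinuousLinearMap.lsmul ℝ ℝ) μ) =
        convolution ((shrinkingBump V j).normed μ) (fderiv ℝ g)
          (ContinuousLinearMap.lsmul ℝ ℝ) μ := by
      intro j
      funext x
      rw [(hc.hasFDerivAt_convolution_right (ContinuousLinearMap.lsmul ℝ ℝ : ℝ →L[ℝ] W →L[ℝ] W)
        ((shrinkingBump V j).continuous_normed.locallyIntegrable (μ := μ)) hg x).fderiv]
      rfl
    simp only [hd]
    exact tendstoUniformly_convolution_shrinkingBump μ (hg.continuous_fderiv one_ne_zero)
      (hc.fderiv ℝ)

/-- Dominated convergence. Eventually `G j` and its derivative are within `1` of `g` and its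
derivative, so over `K` the arguments of `F` stay in a fixed compact set, where `F` is bounded; off
`K` the integrand vanishes. -/
theorem tendsto_integral_comp_fderiv {g : V → W} (hg : ContDiff ℝ 1 g) (hc : HasCompactSupport g)
    {G : ℕ → V → W} (hG : ∀ j, ContDiff ℝ 2 (G j)) (h0 : TendstoUniformly G g atTop)
    (h1 : TendstoUniformly (fun j => fderiv ℝ (G j)) (fderiv ℝ g) atTop)
    {F : W × (V →L[ℝ] W) × V → ℝ} (hF : Continuous F) {K : Set V} (hK : IsCompact K)
    (hFK : ∀ y A x, x ∉ K → F (y, A, x) = 0) :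
    Tendsto (fun j => ∫ x, F (G j x, fderiv ℝ (G j) x, x) ∂μ) atTop
      (𝓝 (∫ x, F (g x, fderiv ℝ g x, x) ∂μ)) := by
  obtain ⟨C, hC⟩ := hg.continuous.bounded_above_of_compact_support hc
  obtain ⟨C', hC'⟩ := (hg.continuous_fderiv one_ne_zero).bounded_above_of_compact_support
    (hc.fderiv ℝ)
  obtain ⟨D, hD⟩ := ((isCompact_closedBall (0 : W) (C + 1)).prod
    ((isCompact_closedBall (0 : V →L[ℝ] W) (C' + 1)).prod hK)).exists_bound_of_continuousOn
    hF.continuousOn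
  refine tendsto_integral_filter_of_dominated_convergence (K.indicator fun _ => D) ?_ ?_ ?_ ?_
  · refine Eventually.of_forall fun j => Continuous.aestronglyMeasurable ?_
    exact hF.comp ((hG j).continuous.prodMk
      (((hG j).continuous_fderiv two_ne_zero).prodMk continuous_id))
  · filter_upwards [Metric.tendstoUniformly_iff.1 h0 1 one_pos,
      Metric.tendstoUniformly_iff.1 h1 1 one_pos] with j hj0 hj1
    refine Eventually.of_forall fun x => ?_
    by_cases hx : x ∈ K
    · rw [indicator_of_mem hx]
      refine hD _ ⟨?_, ?_, hx⟩
      · rw [mem_closedBall_zero_iff]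
        have a := hj0 x
        rw [dist_eq_norm_sub'] at a
        have b := norm_add_le (g x) (G j x - g x)
        rw [add_sub_cancel] at b
        linarith [hC x]
      · rw [mem_closedBall_zero_iff]
        have a := hj1 x
        rw [dist_eq_norm_sub'] at a
        have b := norm_add_le (fderiv ℝ g x) (fderiv ℝ (G j) x - fderiv ℝ g x)
        rw [add_sub_cancel] at b
        simp only
        linarith [hC' x]
    · rw [indicator_of_notMem hx, hFK _ _ _ hx, norm_zero]
  · exact (integrable_indicator_iff hK.measurableSet).2
      (integrableOn_const hK.measure_lt_top.ne)
  · refine Eventually.of_forall fun x => ?_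
    exact (hF.tendsto _).comp ((h0.tendsto_at x).prodMk_nhds
      ((h1.tendsto_at x).prodMk_nhds tendsto_const_nhds))

/-- The distributional exterior derivative of the pullback by a `C^1` map, in vector spaces. -/
theorem integral_pullback_wedge_extDeriv {g : V → W} (hg : ContDiff ℝ 1 g)
    (hgc : HasCompactSupport g) {ω : W → W [⋀^Fin p]→L[ℝ] ℝ} (hω : ContDiff ℝ 1 ω)
    {φ : V → V [⋀^Fin q]→L[ℝ] ℝ} (hφ : ContDiff ℝ 1 φ)
    (hc : HasCompactSupport φ) (h1 : p + (q + 1) = m) (h2 : p + 1 + q = m) (v : Fin m → V) :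
    ∫ x, ((ω (g x)).compContinuousLinearMap (fderiv ℝ g x)).wedge (extDeriv φ x)
        (fun i => v (Fin.cast h1 i)) ∂μ =
      (-1) ^ (p + 1) * ∫ x, ((extDeriv ω (g x)).compContinuousLinearMap (fderiv ℝ g x)).wedge (φ x)
        (fun i => v (Fin.cast h2 i)) ∂μ := by
  obtain ⟨G, hG, hG0, hG1⟩ := exists_contDiff_tendstoUniformly hg hgc
  let F1 : W × (V →L[ℝ] W) × V → ℝ := fun z =>
    ((ω z.1).compContinuousLinearMap z.2.1).wedge (extDeriv φ z.2.2) (fun i => v (Fin.cast h1 i))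
  let F2 : W × (V →L[ℝ] W) × V → ℝ := fun z =>
    ((extDeriv ω z.1).compContinuousLinearMap z.2.1).wedge (φ z.2.2) (fun i => v (Fin.cast h2 i))
  have hF1 : Continuous F1 := by
    have a := continuousOn_wedge (s := univ) (continuousOn_compContinuousLinearMap (s := univ)
      (f := fun z : W × (V →L[ℝ] W) × V => ω z.1) (A := fun z => z.2.1)
      (hω.continuous.comp continuous_fst).continuousOn
      (continuous_fst.comp continuous_snd).continuousOn)
      ((continuous_extDeriv hφ).comp (continuous_snd.comp continuous_snd)).continuousOn
    exact (ContinuousAlternatingMap.apply ℝ V ℝ _).continuous.comp (continuousOn_univ.1 a)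
  have hF2 : Continuous F2 := by
    have a := continuousOn_wedge (s := univ) (continuousOn_compContinuousLinearMap (s := univ)
      (f := fun z : W × (V →L[ℝ] W) × V => extDeriv ω z.1) (A := fun z => z.2.1)
      ((continuous_extDeriv hω).comp continuous_fst).continuousOn
      (continuous_fst.comp continuous_snd).continuousOn)
      (hφ.continuous.comp (continuous_snd.comp continuous_snd)).continuousOn
    exact (ContinuousAlternatingMap.apply ℝ V ℝ _).continuous.comp (continuousOn_univ.1 a)
  -- Both integrands are continuous in `(g, Dg, x)` and vanish off the support of `φ`, so
  -- `C¹`-uniform convergence suffices for both sides.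
  have t1 := tendsto_integral_comp_fderiv μ hg hgc hG hG0 hG1 hF1 hc.isCompact
    (fun y A x hx => by simp [F1, extDeriv_eq_zero_of_notMem_tsupport hx])
  have t2 := tendsto_integral_comp_fderiv μ hg hgc hG hG0 hG1 hF2 hc.isCompact
    (fun y A x hx => by simp [F2, image_eq_zero_of_notMem_tsupport hx])
  refine tendsto_nhds_unique t1 ((t2.const_mul ((-1) ^ (p + 1))).congr fun j => ?_)
  -- `G j` is `C²`, hence its pullback of `ω` is `C¹` and commutes with `extDeriv`: the classical
  -- case applies to each `j`.
  have hpb : ContDiff ℝ 1 fun x => (ω (G j x)).compContinuousLinearMap (fderiv ℝ (G j) x) := by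
    rw [← contDiffOn_univ]
    exact contDiffOn_compContinuousLinearMap (hω.comp ((hG j).of_le one_le_two)).contDiffOn
      ((hG j).fderiv_right (m := 1) (by norm_num)).contDiffOn
  have key := integral_wedge_extDeriv_of_contDiff μ hpb hφ hc h1 h2 v
  refine Eq.trans ?_ key.symm
  congr 1
  refine integral_congr_ae (Eventually.of_forall fun x => ?_)
  have := extDeriv_pullback (ω := ω) (f := G j) (x := x) (r := 2)
    (hω.differentiable one_ne_zero _) (hG j).contDiffAt (by simp)
  simp only [F2, this]

end Core

/-! ### Forms, pullback and exterior derivative in coordinates -/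

namespace DiffForm

open Filter Topology

section Coordinates

variable {m n : ℕ} {M : Type*} [TopologicalSpace M] [ChartedSpace (EuclideanSpace ℝ (Fin m)) M]
  {N : Type*} [TopologicalSpace N] [ChartedSpace (EuclideanSpace ℝ (Fin n)) N] {h q : ℕ}
  {r : WithTop ℕ∞} {e e' : OpenPartialHomeomorph M (EuclideanSpace ℝ (Fin m))}
  {c : OpenPartialHomeomorph N (EuclideanSpace ℝ (Fin n))} {f : M → N}

/-- The domain of the coordinate representation `c ∘ f ∘ e⁻¹` of `f`. -/
def coordDomain (e : OpenPartialHomeomorph M (EuclideanSpace ℝ (Fin m)))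
    (c : OpenPartialHomeomorph N (EuclideanSpace ℝ (Fin n))) (f : M → N) :
    Set (EuclideanSpace ℝ (Fin m)) :=
  e.target ∩ e.symm ⁻¹' (f ⁻¹' c.source)

omit [ChartedSpace (EuclideanSpace ℝ (Fin m)) M]
  [ChartedSpace (EuclideanSpace ℝ (Fin n)) N] in
theorem isOpen_coordDomain (hf : Continuous f) : IsOpen (coordDomain e c f) :=
  e.isOpen_inter_preimage_symm (c.open_source.preimage hf)

theorem contDiffOn_coord (he : e ∈ IsManifold.maximalAtlas (𝓡 m) r M)
    (hc : c ∈ IsManifold.maximalAtlas (𝓡 n) r N) (hf : ContMDiff (𝓡 m) (𝓡 n) r f) :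
    ContDiffOn ℝ r (c ∘ f ∘ e.symm) (coordDomain e c f) := by
  rw [← contMDiffOn_iff_contDiffOn]
  refine (contMDiffOn_of_mem_maximalAtlas hc).comp
    (hf.comp_contMDiffOn ((contMDiffOn_symm_of_mem_maximalAtlas he).mono inter_subset_left)) ?_
  exact fun y hy => hy.2

theorem contDiffOn_transition (he : e ∈ IsManifold.maximalAtlas (𝓡 m) r M)
    (he' : e' ∈ IsManifold.maximalAtlas (𝓡 m) r M) :
    ContDiffOn ℝ r (e' ∘ e.symm) (coordDomain e e' id) :=
  contDiffOn_coord he he' contMDiff_id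

/-- All tangent spaces are definitionally the model space. This allows the base point to be changed
without a dependent rewrite. -/
theorem apply_congr_point (ω : DiffForm m M h) {x x' : M} (hx : x = x')
    (v : Fin h → EuclideanSpace ℝ (Fin m)) : (ω x v : ℝ) = ω x' v := by
  subst hx
  rfl

theorem mdifferentiableAt_symm (hr : r ≠ 0) (he : e ∈ IsManifold.maximalAtlas (𝓡 m) r M)
    {y : EuclideanSpace ℝ (Fin m)} (hy : y ∈ e.target) :
    MDifferentiableAt (𝓡 m) (𝓡 m) e.symm y :=
  ((contMDiffOn_symm_of_mem_maximalAtlas he).contMDiffAt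
    (e.open_target.mem_nhds hy)).mdifferentiableAt hr

theorem mdifferentiableAt_chart (hr : r ≠ 0) (he : e ∈ IsManifold.maximalAtlas (𝓡 m) r M)
    {x : M} (hx : x ∈ e.source) : MDifferentiableAt (𝓡 m) (𝓡 m) e x :=
  ((contMDiffOn_of_mem_maximalAtlas he).contMDiffAt
    (e.open_source.mem_nhds hx)).mdifferentiableAt hr

/-- The local representation of a pullback is the pullback of the local representation by the
coordinate representation of the map. -/
theorem inChart_pullback (hr : r ≠ 0) (he : e ∈ IsManifold.maximalAtlas (𝓡 m) r M)
    (hc : c ∈ IsManifold.maximalAtlas (𝓡 n) r N) (hf : ContMDiff (𝓡 m) (𝓡 n) r f)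
    (ω : DiffForm n N h) {y : EuclideanSpace ℝ (Fin m)} (hy : y ∈ coordDomain e c f) :
    (pullback f ω : DiffForm m M h).inChart e y =
      (ω.inChart c ((c ∘ f ∘ e.symm) y)).compContinuousLinearMap
        (fderiv ℝ (c ∘ f ∘ e.symm) y) := by
  have hopen : IsOpen (coordDomain e c f) := isOpen_coordDomain hf.continuous
  have hsymm := mdifferentiableAt_symm hr he hy.1
  have hfd : MDifferentiableAt (𝓡 m) (𝓡 n) f (e.symm y) := hf.mdifferentiable hr _
  have hg : MDifferentiableAt (𝓡 m) (𝓡 n) (c ∘ f ∘ e.symm) y :=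
    mdifferentiableAt_iff_differentiableAt.2
      (((contDiffOn_coord he hc hf).contDiffAt (hopen.mem_nhds hy)).differentiableAt hr)
  have hcs : MDifferentiableAt (𝓡 n) (𝓡 n) c.symm ((c ∘ f ∘ e.symm) y) :=
    mdifferentiableAt_symm hr hc (c.map_source hy.2)
  -- The chain rule applied to both sides of this germ identity gives the equality of differentials
  -- `hder`.
  have hEq : c.symm ∘ (c ∘ f ∘ e.symm) =ᶠ[𝓝 y] f ∘ e.symm := by
    filter_upwards [hopen.mem_nhds hy] with z hz
    exact c.left_inv hz.2
  have hder : ∀ w : EuclideanSpace ℝ (Fin m),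
      (mfderiv (𝓡 n) (𝓡 n) c.symm ((c ∘ f ∘ e.symm) y) (fderiv ℝ (c ∘ f ∘ e.symm) y w) :
        EuclideanSpace ℝ (Fin n)) =
      mfderiv (𝓡 m) (𝓡 n) f (e.symm y) (mfderiv (𝓡 m) (𝓡 m) e.symm y w) := by
    intro w
    have h1 := mfderiv_comp_apply y hcs hg w
    have h2 := mfderiv_comp_apply y hfd hsymm w
    have h3 := hEq.mfderiv_eq (I := 𝓡 m) (I' := 𝓡 n)
    rw [mfderiv_eq_fderiv] at h1
    refine h1.symm.trans (Eq.trans ?_ h2)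
    exact congrArg (fun A : EuclideanSpace ℝ (Fin m) →L[ℝ] EuclideanSpace ℝ (Fin n) => A w) h3
  ext v
  refine Eq.trans ?_ (apply_congr_point ω (c.left_inv hy.2).symm _)
  refine congrArg (fun u : Fin h → EuclideanSpace ℝ (Fin n) => (ω (f (e.symm y)) u : ℝ)) ?_
  funext i
  exact (hder (v i)).symm

theorem pullback_id (ω : DiffForm m M h) : pullback id ω = ω := by
  funext x
  ext v
  simp only [pullback, mfderiv_id]
  rfl

theorem inChart_transition (hr : r ≠ 0) (he : e ∈ IsManifold.maximalAtlas (𝓡 m) r M)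
    (he' : e' ∈ IsManifold.maximalAtlas (𝓡 m) r M) (ω : DiffForm m M h)
    {y : EuclideanSpace ℝ (Fin m)} (hy : y ∈ coordDomain e e' id) :
    ω.inChart e y = (ω.inChart e' (e' (e.symm y))).compContinuousLinearMap
      (fderiv ℝ (e' ∘ e.symm) y) := by
  have := inChart_pullback hr he he' contMDiff_id ω hy
  rwa [pullback_id] at this

theorem inChart_wedge (ω : DiffForm m M h) (η : DiffForm m M q)
    (e : OpenPartialHomeomorph M (EuclideanSpace ℝ (Fin m))) (y : EuclideanSpace ℝ (Fin m)) :
    (ω.wedge η).inChart e y = (ω.inChart e y).wedge (η.inChart e y) :=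
  ContinuousAlternatingMap.wedge_compContinuousLinearMap _ _ _

omit [ChartedSpace (EuclideanSpace ℝ (Fin m)) M] in
theorem mem_coordDomain_chartAt {y : EuclideanSpace ℝ (Fin m)} (hy : y ∈ e.target) (f : M → N) :
    y ∈ coordDomain e (chartAt (EuclideanSpace ℝ (Fin n)) (f (e.symm y))) f :=
  ⟨hy, mem_chart_source _ _⟩

/-- `IsClass` refers to the given atlas, while oriented charts lie only in the maximal atlas. The
transformation rule contains the Jacobian of the transition map, which costs one derivative. -/
theorem IsClass.contDiffOn_inChart {p : ℕ∞} {ω : DiffForm m M h} (hω : ω.IsClass p)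
    (hpr : (p : WithTop ℕ∞) + 1 ≤ r) [IsManifold (𝓡 m) r M]
    (he : e ∈ IsManifold.maximalAtlas (𝓡 m) r M) :
    ContDiffOn ℝ p (ω.inChart e) e.target := by
  have h1r : 1 ≤ r := le_trans (by simp) hpr
  have hr : r ≠ 0 := (zero_lt_one.trans_le h1r).ne'
  refine contDiffOn_of_locally_contDiffOn fun y hy => ?_
  set c := chartAt (EuclideanSpace ℝ (Fin m)) (e.symm y) with hc
  have hcm : c ∈ IsManifold.maximalAtlas (𝓡 m) r M := IsManifold.chart_mem_maximalAtlas _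
  have hopen : IsOpen (coordDomain e c id) := isOpen_coordDomain continuous_id
  have ht := contDiffOn_transition he hcm
  refine ⟨coordDomain e c id, hopen, mem_coordDomain_chartAt hy id, ?_⟩
  have h1 : ContDiffOn ℝ p (fun y => (ω.inChart c ((c ∘ e.symm) y)).compContinuousLinearMap
      (fderiv ℝ (c ∘ e.symm) y)) (coordDomain e c id) := by
    refine ContinuousAlternatingMap.contDiffOn_compContinuousLinearMap ?_
      (ht.fderiv_of_isOpen hopen hpr)
    exact (hω c (chart_mem_atlas _ _)).comp (ht.of_le (le_self_add.trans hpr))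
      fun z hz => c.map_source hz.2
  exact h1.congr_mono (fun z hz => inChart_transition hr he hcm ω hz.2) inter_subset_right

theorem IsClass.of_le {p p' : ℕ∞} {ω : DiffForm m M h} (hω : ω.IsClass p) (hp : p' ≤ p) :
    ω.IsClass p' :=
  fun e he => (hω e he).of_le (by exact_mod_cast hp)

/-- The exterior derivative is computed by `extDeriv` in every chart. -/
theorem inChart_d {ω : DiffForm m M h} (hω : ω.IsClass 1) (hr : 2 ≤ r) [IsManifold (𝓡 m) r M]
    (he : e ∈ IsManifold.maximalAtlas (𝓡 m) r M)
    {y : EuclideanSpace ℝ (Fin m)} (hy : y ∈ e.target) :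
    ω.d.inChart e y = extDeriv (ω.inChart e) y := by
  have hr0 : r ≠ 0 := (zero_lt_two.trans_le hr).ne'
  set c := chartAt (EuclideanSpace ℝ (Fin m)) (e.symm y) with hc
  have hcm : c ∈ IsManifold.maximalAtlas (𝓡 m) r M := IsManifold.chart_mem_maximalAtlas _
  have hopen : IsOpen (coordDomain e c id) := isOpen_coordDomain continuous_id
  have hyd : y ∈ coordDomain e c id := mem_coordDomain_chartAt hy id
  have ht := contDiffOn_transition he hcm
  have hEq : ω.inChart e =ᶠ[𝓝 y] fun z => (ω.inChart c ((c ∘ e.symm) z)).compContinuousLinearMap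
      (fderiv ℝ (c ∘ e.symm) z) := by
    filter_upwards [hopen.mem_nhds hyd] with z hz
    exact inChart_transition hr0 he hcm ω hz
  have hωc : DifferentiableAt ℝ (ω.inChart c) ((c ∘ e.symm) y) :=
    ((hω c (chart_mem_atlas _ _)).contDiffAt (c.open_target.mem_nhds
      (c.map_source hyd.2))).differentiableAt (by simp)
  -- Commuting `extDeriv` with the transition map needs the latter to be `C²`, hence `2 ≤ r`.
  rw [hEq.extDeriv_eq, extDeriv_pullback hωc (ht.contDiffAt (hopen.mem_nhds hyd)) (by simpa)]
  have hder : ∀ w : EuclideanSpace ℝ (Fin m), (fderiv ℝ (c ∘ e.symm) y w :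
      EuclideanSpace ℝ (Fin m)) =
      mfderiv (𝓡 m) (𝓡 m) c (e.symm y) (mfderiv (𝓡 m) (𝓡 m) e.symm y w) := by
    intro w
    have h1 := mfderiv_comp_apply y (mdifferentiableAt_chart hr0 hcm hyd.2)
      (mdifferentiableAt_symm hr0 he hy) w
    rw [mfderiv_eq_fderiv] at h1
    exact h1
  ext v
  refine congrArg (extDeriv (ω.inChart c) (c (e.symm y))) ?_
  funext i
  exact (hder (v i)).symm

theorem IsClass.d {ω : DiffForm m M h} (hω : ω.IsClass 1) [IsManifold (𝓡 m) 2 M] :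
    ω.d.IsClass 0 := by
  intro e he
  have hem : e ∈ IsManifold.maximalAtlas (𝓡 m) 2 M := IsManifold.subset_maximalAtlas he
  refine contDiffOn_zero.2 (ContinuousOn.congr ?_ fun y hy => inChart_d hω le_rfl hem hy)
  exact (ContinuousAlternatingMap.alternatizeUncurryFinCLM ℝ _ ℝ).continuous.comp_continuousOn
    ((hω e he).continuousOn_fderiv_of_isOpen e.open_target (by simp))

/-- The pullback of a continuous form by a `C^1` map is continuous. -/
theorem IsClass.pullback [IsManifold (𝓡 m) 1 M] [IsManifold (𝓡 n) 1 N] {ω : DiffForm n N h}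
    (hω : ω.IsClass 0) (hf : ContMDiff (𝓡 m) (𝓡 n) 1 f) :
    (DiffForm.pullback f ω : DiffForm m M h).IsClass 0 := by
  intro e he
  have hem : e ∈ IsManifold.maximalAtlas (𝓡 m) 1 M := IsManifold.subset_maximalAtlas he
  refine contDiffOn_of_locally_contDiffOn fun y hy => ?_
  set c := chartAt (EuclideanSpace ℝ (Fin n)) (f (e.symm y)) with hc
  have hcm : c ∈ IsManifold.maximalAtlas (𝓡 n) 1 N := IsManifold.chart_mem_maximalAtlas _
  have hopen : IsOpen (coordDomain e c f) := isOpen_coordDomain hf.continuous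
  have hg := contDiffOn_coord hem hcm hf
  refine ⟨coordDomain e c f, hopen, mem_coordDomain_chartAt hy f, ?_⟩
  have h1 : ContDiffOn ℝ 0 (fun y => (ω.inChart c ((c ∘ f ∘ e.symm) y)).compContinuousLinearMap
      (fderiv ℝ (c ∘ f ∘ e.symm) y)) (coordDomain e c f) := by
    refine ContinuousAlternatingMap.contDiffOn_compContinuousLinearMap ?_
      (hg.fderiv_of_isOpen hopen (by simp))
    exact (hω c (chart_mem_atlas _ _)).comp (hg.of_le (by simp))
      fun z hz => c.map_source hz.2
  exact h1.congr_mono (fun z hz => inChart_pullback one_ne_zero hem hcm hf ω hz.2)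
    inter_subset_right

end Coordinates

end DiffForm

/-! ### Forms of top degree -/

namespace DiffForm

section TopDegree

variable {m h : ℕ} {M : Type*} [TopologicalSpace M] [ChartedSpace (EuclideanSpace ℝ (Fin m)) M]
  {r : WithTop ℕ∞} {e e' : OpenPartialHomeomorph M (EuclideanSpace ℝ (Fin m))}

/-- A form of top degree is a multiple of the determinant in a basis. -/
theorem _root_.ContinuousAlternatingMap.map_basis_of_top_degree (hh : h = m)
    (a : EuclideanSpace ℝ (Fin m) [⋀^Fin h]→L[ℝ] ℝ)
    (A : EuclideanSpace ℝ (Fin m) →L[ℝ] EuclideanSpace ℝ (Fin m)) :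
    (a.compContinuousLinearMap A) (fun i => EuclideanSpace.basisFun (Fin m) ℝ (Fin.cast hh i)) =
      A.det * a (fun i => EuclideanSpace.basisFun (Fin m) ℝ (Fin.cast hh i)) := by
  subst hh
  let b := (EuclideanSpace.basisFun (Fin h) ℝ).toBasis
  have ha := a.toAlternatingMap.eq_smul_basis_det b
  have h1 : ∀ v, a v = a b * b.det v := fun v => DFunLike.congr_fun ha v
  have h2 : (fun i => EuclideanSpace.basisFun (Fin h) ℝ (Fin.cast rfl i)) = b := by
    funext i
    simp [b]
  rw [h2, ContinuousAlternatingMap.compContinuousLinearMap_apply, h1, h1 b]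
  have h3 := b.det_comp (A : EuclideanSpace ℝ (Fin h) →ₗ[ℝ] EuclideanSpace ℝ (Fin h)) b
  have h4 : b.det (A ∘ b) = A.det * b.det b := h3
  rw [h4, b.det_self]
  ring

theorem topCoeff_transition (hr : r ≠ 0) (hh : h = m)
    (he : e ∈ IsManifold.maximalAtlas (𝓡 m) r M)
    (he' : e' ∈ IsManifold.maximalAtlas (𝓡 m) r M) (τ : DiffForm m M h)
    {y : EuclideanSpace ℝ (Fin m)} (hy : y ∈ coordDomain e e' id) :
    τ.topCoeff hh e y =
      (fderiv ℝ (e' ∘ e.symm) y).det * τ.topCoeff hh e' (e' (e.symm y)) := by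
  unfold topCoeff
  rw [inChart_transition hr he he' τ hy]
  exact ContinuousAlternatingMap.map_basis_of_top_degree hh _ _

theorem topCoeff_eq_zero (hh : h = m) {τ : DiffForm m M h} {y : EuclideanSpace ℝ (Fin m)}
    (hy : τ (e.symm y) = 0) : τ.topCoeff hh e y = 0 := by
  unfold topCoeff inChart
  rw [hy]
  rfl

theorem IsClass.continuousOn_topCoeff {τ : DiffForm m M h} (hτ : τ.IsClass 0) (hh : h = m)
    (hr : 1 ≤ r) [IsManifold (𝓡 m) r M] (he : e ∈ IsManifold.maximalAtlas (𝓡 m) r M) :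
    ContinuousOn (τ.topCoeff hh e) e.target :=
  (ContinuousAlternatingMap.apply ℝ _ ℝ _).continuous.comp_continuousOn
    (hτ.contDiffOn_inChart (by simpa using hr) he).continuousOn

theorem topCoeff_add (hh : h = m) (τ τ' : DiffForm m M h)
    (y : EuclideanSpace ℝ (Fin m)) :
    topCoeff hh (fun x => τ x + τ' x) e y = τ.topCoeff hh e y + τ'.topCoeff hh e y := rfl

theorem topCoeff_sum {α : Type*} (s : Finset α) (hh : h = m) (τ : α → DiffForm m M h)
    (y : EuclideanSpace ℝ (Fin m)) :
    topCoeff hh (fun x => ∑ a ∈ s, τ a x) e y = ∑ a ∈ s, (τ a).topCoeff hh e y := by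
  classical
  induction s using Finset.induction_on with
  | empty => rfl
  | insert a s has ih =>
    rw [Finset.sum_insert has, ← ih, ← topCoeff_add]
    simp only [Finset.sum_insert has]

theorem HasCompactSupp.notMem {τ : DiffForm m M h} {x : M} (hx : x ∉ closure {x | τ x ≠ 0}) :
    τ x = 0 := by
  by_contra h0
  exact hx (subset_closure h0)

theorem HasCompactSupp.of_forall_notMem [T2Space M] {τ : DiffForm m M h} {K : Set M}
    (hK : IsCompact K) (h0 : ∀ x ∉ K, τ x = 0) : τ.HasCompactSupp :=
  hK.of_isClosed_subset isClosed_closure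
    (closure_minimal (fun x hx => by_contra fun hxK => hx (h0 x hxK)) hK.isClosed)

/-- The integrand is continuous on the compact set `e '' K` and vanishes on the rest of the chart.
-/
theorem integrableOn_mul_topCoeff {τ : DiffForm m M h} (hτ : τ.IsClass 0) (hh : h = m)
    (hr : 1 ≤ r) [IsManifold (𝓡 m) r M] (he : e ∈ IsManifold.maximalAtlas (𝓡 m) r M)
    {K : Set M} (hK : IsCompact K) {ρ : M → ℝ} (hρ : Continuous ρ)
    (hKe : K ⊆ e.source) (h0 : ∀ x ∉ K, ρ x = 0 ∨ τ x = 0) :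
    IntegrableOn (fun y => ρ (e.symm y) * τ.topCoeff hh e y) e.target := by
  have hS : IsCompact (e '' K) := hK.image_of_continuousOn (e.continuousOn.mono hKe)
  have hSe : e '' K ⊆ e.target := by
    rintro _ ⟨x, hx, rfl⟩
    exact e.map_source (hKe hx)
  have hcont : ContinuousOn (fun y => ρ (e.symm y) * τ.topCoeff hh e y) e.target :=
    (hρ.comp_continuousOn e.continuousOn_symm).mul (hτ.continuousOn_topCoeff hh hr he)
  refine ((hcont.mono hSe).integrableOn_compact hS).of_forall_sdiff_eq_zero
    e.open_target.measurableSet fun y hy => ?_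
  have : e.symm y ∉ K := fun hyK => hy.2 ⟨_, hyK, e.right_inv hy.1⟩
  rcases h0 _ this with h1 | h1
  · simp [h1]
  · simp [topCoeff_eq_zero hh h1]

end TopDegree

end DiffForm

/-! ### The integral over an oriented manifold -/

namespace OrientedAtlas

open DiffForm

variable {m h : ℕ} {k : ℕ∞} {M : Type*} [TopologicalSpace M]
  [ChartedSpace (EuclideanSpace ℝ (Fin m)) M] [T2Space M] [SecondCountableTopology M]

theorem finite_setOf_integral_ne_zero (o : OrientedAtlas m k M) (hh : h = m) {τ : DiffForm m M h}
    (hc : τ.HasCompactSupp) :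
    (Function.support fun i => ∫ y in (o.chart i).target,
      o.partition i ((o.chart i).symm y) * τ.topCoeff hh (o.chart i) y).Finite := by
  refine (o.partition.locallyFinite.finite_nonempty_inter_compact hc).subset fun i hi => ?_
  by_contra hne
  refine hi (setIntegral_eq_zero_of_forall_eq_zero fun y _ => ?_)
  by_cases hy : (o.chart i).symm y ∈ closure {x | τ x ≠ 0}
  · have : o.partition i ((o.chart i).symm y) = 0 := by
      by_contra h0
      exact hne ⟨_, h0, hy⟩
    rw [this, zero_mul]
  · rw [topCoeff_eq_zero hh (HasCompactSupp.notMem hy), mul_zero]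

theorem integrableOn_partition_mul_topCoeff (o : OrientedAtlas m k M) [IsManifold (𝓡 m) k M]
    (hk : 1 ≤ k) (hh : h = m) {τ : DiffForm m M h} (hτ : τ.IsClass 0) (hc : τ.HasCompactSupp)
    (i : M) : IntegrableOn (fun y => o.partition i ((o.chart i).symm y) *
      τ.topCoeff hh (o.chart i) y) (o.chart i).target := by
  refine integrableOn_mul_topCoeff (r := k) hτ hh (by exact_mod_cast hk)
    (o.mem_maximalAtlas _ (o.chart_mem i)) (K := tsupport (o.partition i) ∩ closure {x | τ x ≠ 0})
    (hc.inter_left (isClosed_tsupport _)) (o.partition i).continuous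
    (inter_subset_left.trans (o.partition_isSubordinate i)) fun x hx => ?_
  by_cases h1 : x ∈ tsupport (o.partition i)
  · exact Or.inr (HasCompactSupp.notMem fun h2 => hx ⟨h1, h2⟩)
  · exact Or.inl (image_eq_zero_of_notMem_tsupport h1)

theorem integral_add (o : OrientedAtlas m k M) [IsManifold (𝓡 m) k M] (hk : 1 ≤ k) (hh : h = m)
    {τ τ' : DiffForm m M h} (hτ : τ.IsClass 0) (hc : τ.HasCompactSupp) (hτ' : τ'.IsClass 0)
    (hc' : τ'.HasCompactSupp) :
    o.integral hh (fun x => τ x + τ' x) = o.integral hh τ + o.integral hh τ' := by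
  unfold integral
  rw [← finsum_add_distrib (o.finite_setOf_integral_ne_zero hh hc)
    (o.finite_setOf_integral_ne_zero hh hc')]
  refine finsum_congr fun i => ?_
  rw [← MeasureTheory.integral_add (o.integrableOn_partition_mul_topCoeff hk hh hτ hc i)
    (o.integrableOn_partition_mul_topCoeff hk hh hτ' hc' i)]
  simp only [topCoeff_add, mul_add]

theorem integral_sum (o : OrientedAtlas m k M) [IsManifold (𝓡 m) k M] (hk : 1 ≤ k) (hh : h = m)
    {α : Type*} (s : Finset α) {τ : α → DiffForm m M h} (hτ : ∀ a, (τ a).IsClass 0)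
    (hc : ∀ a, (τ a).HasCompactSupp) :
    o.integral hh (fun x => ∑ a ∈ s, τ a x) = ∑ a ∈ s, o.integral hh (τ a) := by
  unfold integral
  rw [← finsum_sum_comm s _ fun a _ => o.finite_setOf_integral_ne_zero hh (hc a)]
  refine finsum_congr fun i => ?_
  rw [← integral_finsetSum s fun a _ => o.integrableOn_partition_mul_topCoeff hk hh (hτ a) (hc a) i]
  simp only [topCoeff_sum, Finset.mul_sum]

omit [T2Space M] [SecondCountableTopology M] in
/-- Change of variables between two charts of an oriented atlas. -/
theorem setIntegral_mul_topCoeff_eq (o : OrientedAtlas m k M) (hk : 1 ≤ k) (hh : h = m)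
    (τ : DiffForm m M h) {e e' : OpenPartialHomeomorph M (EuclideanSpace ℝ (Fin m))}
    (he : e ∈ o.charts) (he' : e' ∈ o.charts) {ρ : M → ℝ}
    (h0 : ∀ x ∉ e.source, τ x = 0) (h0' : ∀ x ∉ e'.source, ρ x = 0) :
    ∫ y in e'.target, ρ (e'.symm y) * τ.topCoeff hh e' y =
      ∫ y in e.target, ρ (e.symm y) * τ.topCoeff hh e y := by
  have hr : (k : WithTop ℕ∞) ≠ 0 := by
    have : k ≠ 0 := (zero_lt_one.trans_le hk).ne'
    exact_mod_cast this
  have hem := o.mem_maximalAtlas e he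
  have hem' := o.mem_maximalAtlas e' he'
  have hD : IsOpen (coordDomain e e' id) := isOpen_coordDomain continuous_id
  have ht := contDiffOn_transition hem hem'
  have himage : (e' ∘ e.symm) '' coordDomain e e' id = coordDomain e' e id := by
    ext z
    constructor
    · rintro ⟨y, hy, rfl⟩
      refine ⟨e'.map_source hy.2, ?_⟩
      change e'.symm (e' (e.symm y)) ∈ e.source
      rw [e'.left_inv (show e.symm y ∈ e'.source from hy.2)]
      exact e.map_target hy.1
    · intro hz
      refine ⟨e (e'.symm z), ⟨e.map_source hz.2, ?_⟩, ?_⟩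
      · change e.symm (e (e'.symm z)) ∈ e'.source
        rw [e.left_inv (show e'.symm z ∈ e.source from hz.2)]
        exact e'.map_target hz.1
      · change e' (e.symm (e (e'.symm z))) = z
        rw [e.left_inv (show e'.symm z ∈ e.source from hz.2), e'.right_inv hz.1]
  have hinj : InjOn (e' ∘ e.symm) (coordDomain e e' id) := fun y hy z hz hyz =>
    e.symm.injOn hy.1 hz.1 (e'.injOn hy.2 hz.2 hyz)
  -- Both integrals live on the overlap: in `e'` because `τ` vanishes off `e.source`, in `e` because
  -- `ρ` vanishes off `e'.source`.
  have h1 : ∫ y in e'.target, ρ (e'.symm y) * τ.topCoeff hh e' y =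
      ∫ y in coordDomain e' e id, ρ (e'.symm y) * τ.topCoeff hh e' y := by
    refine setIntegral_eq_of_subset_of_forall_sdiff_eq_zero e'.open_target.measurableSet
      inter_subset_left fun y hy => ?_
    rw [topCoeff_eq_zero hh (h0 (e'.symm y) fun hx => hy.2 ⟨hy.1, hx⟩), mul_zero]
  have h2 : ∫ y in e.target, ρ (e.symm y) * τ.topCoeff hh e y =
      ∫ y in coordDomain e e' id, ρ (e.symm y) * τ.topCoeff hh e y := by
    refine setIntegral_eq_of_subset_of_forall_sdiff_eq_zero e.open_target.measurableSet
      inter_subset_left fun y hy => ?_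
    rw [h0' (e.symm y) fun hx => hy.2 ⟨hy.1, hx⟩, zero_mul]
  rw [h1, h2, ← himage, integral_image_eq_integral_abs_det_fderiv_smul volume hD.measurableSet
    (fun y hy => ((ht.contDiffAt (hD.mem_nhds hy)).differentiableAt hr).hasFDerivAt.hasFDerivWithinAt)
    hinj]
  refine setIntegral_congr_fun hD.measurableSet fun y hy => ?_
  -- Orientation enters here: the absolute value in the change of variables can be dropped.
  have hdet : 0 < (fderiv ℝ (e' ∘ e.symm) y).det := o.det_pos e he e' he' y hy
  have hl : e'.symm (e' (e.symm y)) = e.symm y := e'.left_inv hy.2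
  simp only [abs_of_pos hdet, smul_eq_mul, Function.comp_apply, hl,
    topCoeff_transition hr hh hem hem' τ hy]
  ring

/-- The integral of a form supported in one oriented chart is computed in this chart. -/
theorem integral_eq_setIntegral_chart (o : OrientedAtlas m k M) [IsManifold (𝓡 m) k M]
    (hk : 1 ≤ k) (hh : h = m) {τ : DiffForm m M h} (hτ : τ.IsClass 0)
    {e : OpenPartialHomeomorph M (EuclideanSpace ℝ (Fin m))} (he : e ∈ o.charts) {K : Set M}
    (hK : IsCompact K) (hKe : K ⊆ e.source) (h0 : ∀ x ∉ K, τ x = 0) :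
    o.integral hh τ = ∫ y in e.target, τ.topCoeff hh e y := by
  have hcc : τ.HasCompactSupp := HasCompactSupp.of_forall_notMem hK h0
  have hchart : ∀ i, ∫ y in (o.chart i).target,
      o.partition i ((o.chart i).symm y) * τ.topCoeff hh (o.chart i) y =
      ∫ y in e.target, o.partition i (e.symm y) * τ.topCoeff hh e y := by
    intro i
    refine o.setIntegral_mul_topCoeff_eq hk hh τ he (o.chart_mem i)
      (fun x hx => h0 x fun hxK => hx (hKe hxK)) fun x hx => ?_
    exact image_eq_zero_of_notMem_tsupport fun h1 => hx (o.partition_isSubordinate i h1)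
  -- Only finitely many partition functions meet `K`, so sum and integral commute; their sum is `1`
  -- on `K`, and `τ` vanishes elsewhere.
  have hfin := o.partition.locallyFinite.finite_nonempty_inter_compact hK
  have hsub : (Function.support fun i => ∫ y in e.target, o.partition i (e.symm y) *
      τ.topCoeff hh e y) ⊆ hfin.toFinset := by
    intro i hi
    rw [Finite.coe_toFinset]
    by_contra hne
    refine hi (setIntegral_eq_zero_of_forall_eq_zero fun y _ => ?_)
    by_cases hy : e.symm y ∈ K
    · have : o.partition i (e.symm y) = 0 := by
        by_contra h1
        exact hne ⟨_, h1, hy⟩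
      rw [this, zero_mul]
    · rw [topCoeff_eq_zero hh (h0 _ hy), mul_zero]
  unfold integral
  simp only [hchart]
  rw [finsum_eq_sum_of_support_subset _ hsub, ← integral_finsetSum]
  · refine setIntegral_congr_fun e.open_target.measurableSet fun y _ => ?_
    simp only [← Finset.sum_mul]
    by_cases hy : e.symm y ∈ K
    · have hone := o.partition.sum_eq_one (mem_univ (e.symm y))
      rw [finsum_eq_sum_of_support_subset (s := hfin.toFinset)] at hone
      · rw [hone, one_mul]
      · intro i hi
        rw [Finite.coe_toFinset]
        exact ⟨_, hi, hy⟩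
    · rw [topCoeff_eq_zero hh (h0 _ hy), mul_zero]
  · intro i _
    exact integrableOn_mul_topCoeff (r := k) hτ hh (by exact_mod_cast hk)
      (o.mem_maximalAtlas e he) hK (o.partition i).continuous hKe fun x hx => Or.inr (h0 x hx)

end OrientedAtlas

/-! ### Cutoff functions on vector spaces -/

section Cutoff

open Filter Topology
open scoped ContDiff

variable {V G : Type*} [NormedAddCommGroup V] [NormedSpace ℝ V] [NormedAddCommGroup G]
  [NormedSpace ℝ G]

/-- The value `1` is required near each point of `K`, so that multiplying by `χ` changes no
derivative there. -/
theorem exists_contDiff_cutoff [FiniteDimensional ℝ V] {K U : Set V} (hK : IsCompact K)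
    (hU : IsOpen U) (hKU : K ⊆ U) :
    ∃ χ : V → ℝ, ContDiff ℝ ∞ χ ∧ HasCompactSupport χ ∧ tsupport χ ⊆ U ∧
      ∀ y ∈ K, ∀ᶠ z in 𝓝 y, χ z = 1 := by
  obtain ⟨L, hL, hKL, hLU⟩ := exists_compact_between hK hU hKU
  obtain ⟨χ, h1, h0, -⟩ := exists_contMDiffMap_one_nhds_of_subset_interior (n := ⊤)
    (modelWithCornersSelf ℝ V) hK.isClosed hKL
  have hsub : tsupport χ ⊆ L := closure_minimal
    (fun x hx => by_contra fun hxL => hx (h0 x hxL)) hL.isClosed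
  exact ⟨χ, χ.contMDiff.contDiff, hL.of_isClosed_subset (isClosed_tsupport _) hsub,
    hsub.trans hLU, fun y hy => eventually_nhdsSet_iff_forall.1 h1 y hy⟩

theorem contDiff_smul_of_tsupport_subset {n : WithTop ℕ∞} {χ : V → ℝ} {F : V → G} {U : Set V}
    (hχ : ContDiff ℝ n χ) (hU : IsOpen U) (hsub : tsupport χ ⊆ U) (hF : ContDiffOn ℝ n F U) :
    ContDiff ℝ n fun y => χ y • F y := by
  rw [contDiff_iff_contDiffAt]
  intro y
  by_cases hy : y ∈ U
  · exact hχ.contDiffAt.smul (hF.contDiffAt (hU.mem_nhds hy))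
  · have : (fun y => χ y • F y) =ᶠ[𝓝 y] fun _ => 0 := by
      filter_upwards [(isClosed_tsupport χ).isOpen_compl.mem_nhds fun h => hy (hsub h)] with z hz
      rw [image_eq_zero_of_notMem_tsupport hz, zero_smul]
    exact contDiffAt_const.congr_of_eventuallyEq this

end Cutoff

/-! ### Transplanting forms from a chart, and the local identity on manifolds -/

namespace DiffForm

open Filter Topology

variable {m n : ℕ} {M : Type*} [TopologicalSpace M] [ChartedSpace (EuclideanSpace ℝ (Fin m)) M]
  {N : Type*} [TopologicalSpace N] [ChartedSpace (EuclideanSpace ℝ (Fin n)) N] {h q : ℕ}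
  {r : WithTop ℕ∞} {e e' : OpenPartialHomeomorph M (EuclideanSpace ℝ (Fin m))}

theorem inChart_eq_zero {ω : DiffForm m M h} {y : EuclideanSpace ℝ (Fin m)}
    (hy : ω (e.symm y) = 0) : ω.inChart e y = 0 := by
  unfold inChart
  rw [hy]
  rfl

theorem d_eq_zero_of_eventuallyEq {ω : DiffForm m M h} {x : M} (hx : ∀ᶠ z in 𝓝 x, ω z = 0) :
    ω.d x = 0 := by
  set c := chartAt (EuclideanSpace ℝ (Fin m)) x with hc
  have hxc : x ∈ c.source := mem_chart_source _ x
  have h0 : ω.inChart c =ᶠ[𝓝 (c x)] fun _ => 0 := by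
    have hcont := c.continuousAt_symm (c.map_source hxc)
    rw [ContinuousAt, c.left_inv hxc] at hcont
    filter_upwards [hcont.eventually hx] with y hy
    exact inChart_eq_zero hy
  have h1 : extDeriv (ω.inChart c) (c x) = 0 := by
    rw [h0.extDeriv_eq]
    ext v
    simp [extDeriv, ContinuousAlternatingMap.alternatizeUncurryFin_apply]
  unfold d
  rw [← hc, h1]
  rfl

theorem d_eq_zero_of_notMem {ω : DiffForm m M h} {K : Set M} (hK : IsClosed K)
    (h0 : ∀ x ∉ K, ω x = 0) {x : M} (hx : x ∉ K) : ω.d x = 0 :=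
  d_eq_zero_of_eventuallyEq (by
    filter_upwards [hK.isOpen_compl.mem_nhds hx] with z hz
    exact h0 z hz)

theorem d_add {ω η : DiffForm m M h} (hω : ω.IsClass 1) (hη : η.IsClass 1) (x : M) :
    d (fun x => ω x + η x) x = ω.d x + η.d x := by
  set c := chartAt (EuclideanSpace ℝ (Fin m)) x with hc
  have hxc : c x ∈ c.target := c.map_source (mem_chart_source _ x)
  have hd : ∀ {ω : DiffForm m M h}, ω.IsClass 1 → DifferentiableAt ℝ (ω.inChart c) (c x) :=
    fun hω => ((hω c (chart_mem_atlas _ _)).contDiffAt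
      (c.open_target.mem_nhds hxc)).differentiableAt (by simp)
  have h1 := extDeriv_add (hd hω) (hd hη)
  have h2 : inChart (fun x => ω x + η x) c = ω.inChart c + η.inChart c := rfl
  unfold d
  rw [← hc, h2, h1]
  rfl

theorem IsClass.wedge {p : ℕ∞} {ω : DiffForm m M h} {η : DiffForm m M q} (hω : ω.IsClass p)
    (hη : η.IsClass p) : (ω.wedge η).IsClass p := fun e he =>
  (ContinuousAlternatingMap.contDiffOn_wedge (hω e he) (hη e he)).congr
    fun y _ => inChart_wedge ω η e y

theorem IsClass.add {p : ℕ∞} {ω η : DiffForm m M h} (hω : ω.IsClass p) (hη : η.IsClass p) :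
    IsClass p fun x => ω x + η x := fun e he => (hω e he).add (hη e he)

theorem IsClass.smul {p : ℕ∞} {χ : M → ℝ} {ω : DiffForm m M h} (hω : ω.IsClass p)
    (hχ : ∀ e ∈ atlas (EuclideanSpace ℝ (Fin m)) M, ContDiffOn ℝ p (χ ∘ e.symm) e.target) :
    IsClass p fun x => χ x • ω x := fun e he => (hχ e he).smul (hω e he)

open Classical in
/-- The function equal to `b` in the chart `e` and to `0` outside. -/
def extendByZero (e : OpenPartialHomeomorph M (EuclideanSpace ℝ (Fin m)))
    (b : EuclideanSpace ℝ (Fin m) → ℝ) (x : M) : ℝ := if x ∈ e.source then b (e x) else 0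

open Classical in
/-- The form whose local representation is `B` in the chart `e`, and `0` outside. -/
def ofChart (e : OpenPartialHomeomorph M (EuclideanSpace ℝ (Fin m)))
    (B : EuclideanSpace ℝ (Fin m) → EuclideanSpace ℝ (Fin m) [⋀^Fin q]→L[ℝ] ℝ) :
    DiffForm m M q := fun x =>
  if x ∈ e.source then (B (e x)).compContinuousLinearMap (mfderiv (𝓡 m) (𝓡 m) e x) else 0

omit [ChartedSpace (EuclideanSpace ℝ (Fin m)) M] in
theorem isCompact_symm_image {S : Set (EuclideanSpace ℝ (Fin m))} (hS : IsCompact S)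
    (hSe : S ⊆ e.target) : IsCompact (e.symm '' S) :=
  hS.image_of_continuousOn (e.continuousOn_symm.mono hSe)

omit [ChartedSpace (EuclideanSpace ℝ (Fin m)) M] in
theorem extendByZero_eq_zero {b : EuclideanSpace ℝ (Fin m) → ℝ} {x : M}
    (hx : x ∉ e.symm '' tsupport b) : extendByZero e b x = 0 := by
  unfold extendByZero
  split_ifs with hxe
  · exact image_eq_zero_of_notMem_tsupport fun h1 => hx ⟨_, h1, e.left_inv hxe⟩
  · rfl

theorem ofChart_eq_zero
    {B : EuclideanSpace ℝ (Fin m) → EuclideanSpace ℝ (Fin m) [⋀^Fin q]→L[ℝ] ℝ} {x : M}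
    (hx : x ∉ e.symm '' tsupport B) : ofChart e B x = 0 := by
  unfold ofChart
  split_ifs with hxe
  · rw [image_eq_zero_of_notMem_tsupport fun h1 => hx ⟨_, h1, e.left_inv hxe⟩]
    rfl
  · rfl

/-- At points outside `e.source` the function vanishes locally, since the compact image of the
support is closed in the Hausdorff space `M`. -/
theorem contDiffOn_extendByZero [T2Space M] (he : e ∈ IsManifold.maximalAtlas (𝓡 m) r M)
    (he' : e' ∈ IsManifold.maximalAtlas (𝓡 m) r M) {b : EuclideanSpace ℝ (Fin m) → ℝ}
    (hb : ContDiff ℝ r b) (hc : HasCompactSupport b) (hsub : tsupport b ⊆ e.target) :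
    ContDiffOn ℝ r (extendByZero e b ∘ e'.symm) e'.target := by
  refine contDiffOn_of_locally_contDiffOn fun y hy => ?_
  by_cases hye : e'.symm y ∈ e.source
  · refine ⟨coordDomain e' e id, isOpen_coordDomain continuous_id, ⟨hy, hye⟩, ?_⟩
    refine (hb.comp_contDiffOn (contDiffOn_transition he' he)).congr_mono (fun z hz => ?_)
      inter_subset_right
    exact if_pos hz.2.2
  · have hK := (isCompact_symm_image hc.isCompact hsub).isClosed
    refine ⟨e'.target ∩ e'.symm ⁻¹' (e.symm '' tsupport b)ᶜ,
      e'.isOpen_inter_preimage_symm hK.isOpen_compl, ⟨hy, ?_⟩, ?_⟩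
    · rintro ⟨z, hz, hzy⟩
      exact hye (hzy ▸ e.map_target (hsub hz))
    · exact contDiffOn_const.congr fun z hz => extendByZero_eq_zero hz.2.2

theorem inChart_ofChart (hr : r ≠ 0) (he : e ∈ IsManifold.maximalAtlas (𝓡 m) r M)
    (B : EuclideanSpace ℝ (Fin m) → EuclideanSpace ℝ (Fin m) [⋀^Fin q]→L[ℝ] ℝ)
    {y : EuclideanSpace ℝ (Fin m)} (hy : y ∈ e.target) : (ofChart e B).inChart e y = B y := by
  have hEq : e ∘ e.symm =ᶠ[𝓝 y] id := by
    filter_upwards [e.open_target.mem_nhds hy] with z hz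
    exact e.right_inv hz
  have hder : ∀ w : EuclideanSpace ℝ (Fin m), (mfderiv (𝓡 m) (𝓡 m) e (e.symm y)
      (mfderiv (𝓡 m) (𝓡 m) e.symm y w) : EuclideanSpace ℝ (Fin m)) = w := by
    intro w
    have h1 := mfderiv_comp_apply y (mdifferentiableAt_chart hr he (e.map_target hy))
      (mdifferentiableAt_symm hr he hy) w
    have h2 := hEq.mfderiv_eq (I := 𝓡 m) (I' := 𝓡 m)
    rw [mfderiv_id] at h2
    refine h1.symm.trans ?_
    exact congrArg (fun A : EuclideanSpace ℝ (Fin m) →L[ℝ] EuclideanSpace ℝ (Fin m) => A w) h2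
  have h3 : ofChart e B (e.symm y) = (B (e (e.symm y))).compContinuousLinearMap
      (mfderiv (𝓡 m) (𝓡 m) e (e.symm y)) := if_pos (e.map_target hy)
  unfold inChart
  rw [h3]
  ext v
  refine Eq.trans ?_ (congrArg (fun z => B z v) (e.right_inv hy))
  refine congrArg (B (e (e.symm y))) ?_
  funext i
  exact hder (v i)

/-- On overlaps the form is `B` pulled back by a transition map, whose Jacobian loses one
derivative; elsewhere it vanishes locally. This is the source of `l + 1 ≤ k` in the uniqueness
statement. -/
theorem isClass_ofChart [T2Space M] [IsManifold (𝓡 m) r M]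
    (he : e ∈ IsManifold.maximalAtlas (𝓡 m) r M)
    {B : EuclideanSpace ℝ (Fin m) → EuclideanSpace ℝ (Fin m) [⋀^Fin q]→L[ℝ] ℝ} {l : ℕ∞}
    (hlr : (l : WithTop ℕ∞) + 1 ≤ r) (hB : ContDiff ℝ l B) (hc : HasCompactSupport B)
    (hsub : tsupport B ⊆ e.target) : (ofChart e B).IsClass l := by
  have h1r : 1 ≤ r := le_trans (by simp) hlr
  have hr : r ≠ 0 := (zero_lt_one.trans_le h1r).ne'
  intro e' he'A
  have he' : e' ∈ IsManifold.maximalAtlas (𝓡 m) r M := IsManifold.subset_maximalAtlas he'A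
  refine contDiffOn_of_locally_contDiffOn fun y hy => ?_
  by_cases hye : e'.symm y ∈ e.source
  · have hopen : IsOpen (coordDomain e' e id) := isOpen_coordDomain continuous_id
    have ht := contDiffOn_transition he' he
    refine ⟨coordDomain e' e id, hopen, ⟨hy, hye⟩, ?_⟩
    have h1 : ContDiffOn ℝ l (fun z => (B ((e ∘ e'.symm) z)).compContinuousLinearMap
        (fderiv ℝ (e ∘ e'.symm) z)) (coordDomain e' e id) :=
      ContinuousAlternatingMap.contDiffOn_compContinuousLinearMap
        (hB.comp_contDiffOn (ht.of_le (le_self_add.trans hlr))) (ht.fderiv_of_isOpen hopen hlr)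
    refine h1.congr_mono (fun z hz => ?_) inter_subset_right
    rw [inChart_transition hr he' he _ hz.2, inChart_ofChart hr he B
      (e.map_source (show e'.symm z ∈ e.source from hz.2.2))]
    rfl
  · have hK := (isCompact_symm_image hc.isCompact hsub).isClosed
    refine ⟨e'.target ∩ e'.symm ⁻¹' (e.symm '' tsupport B)ᶜ,
      e'.isOpen_inter_preimage_symm hK.isOpen_compl, ⟨hy, ?_⟩, ?_⟩
    · rintro ⟨z, hz, hzy⟩
      exact hye (hzy ▸ e.map_target (hsub hz))
    · exact contDiffOn_const.congr fun z hz => inChart_eq_zero (ofChart_eq_zero hz.2.2)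

variable [T2Space M] [SecondCountableTopology M] {k : ℕ∞}

/-- The distributional identity for test forms supported in one pair of charts. -/
theorem integral_pullback_wedge_d_of_support_subset [IsManifold (𝓡 m) k M]
    [IsManifold (𝓡 n) 2 N] (hk : 2 ≤ k) (o : OrientedAtlas m k M) {f : M → N}
    (hf : ContMDiff (𝓡 m) (𝓡 n) 1 f) {ω : DiffForm n N h} (hω : ω.IsClass 1)
    {φ : DiffForm m M q} (hφ : φ.IsClass 1) (h1 : h + (q + 1) = m) (h2 : h + 1 + q = m)
    (he : e ∈ o.charts) {c : OpenPartialHomeomorph N (EuclideanSpace ℝ (Fin n))}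
    (hc : c ∈ IsManifold.maximalAtlas (𝓡 n) 2 N) {K : Set M} (hK : IsCompact K)
    (hKe : K ⊆ e.source) (hKc : K ⊆ f ⁻¹' c.source) (h0 : ∀ x ∉ K, φ x = 0) :
    o.integral h1 ((pullback f ω).wedge φ.d) =
      (-1) ^ (h + 1) * o.integral h2 ((pullback f ω.d).wedge φ) := by
  have hk2 : (2 : WithTop ℕ∞) ≤ k := WithTop.coe_le_coe.2 hk
  have hk1 : (1 : ℕ∞) ≤ k := one_le_two.trans hk
  have : IsManifold (𝓡 m) 2 M := IsManifold.of_le hk2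
  have : IsManifold (𝓡 m) 1 M := IsManifold.of_le one_le_two
  have : IsManifold (𝓡 n) 1 N := IsManifold.of_le (n := 2) one_le_two
  have hek := o.mem_maximalAtlas e he
  have he2 : e ∈ IsManifold.maximalAtlas (𝓡 m) 2 M :=
    IsManifold.maximalAtlas_subset_of_le hk2 hek
  have he1 : e ∈ IsManifold.maximalAtlas (𝓡 m) 1 M :=
    IsManifold.maximalAtlas_subset_of_le one_le_two he2
  have hc1 : c ∈ IsManifold.maximalAtlas (𝓡 n) 1 N :=
    IsManifold.maximalAtlas_subset_of_le one_le_two hc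
  have hτ1 : ((pullback f ω : DiffForm m M h).wedge φ.d).IsClass 0 :=
    ((hω.of_le zero_le_one).pullback hf).wedge hφ.d
  have hτ2 : ((pullback f ω.d : DiffForm m M (h + 1)).wedge φ).IsClass 0 :=
    (hω.d.pullback hf).wedge (hφ.of_le zero_le_one)
  rw [o.integral_eq_setIntegral_chart hk1 h1 hτ1 he hK hKe fun x hx => by
      unfold wedge
      rw [d_eq_zero_of_notMem hK.isClosed h0 hx]
      exact ContinuousAlternatingMap.wedge_zero _,
    o.integral_eq_setIntegral_chart hk1 h2 hτ2 he hK hKe fun x hx => by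
      unfold wedge
      rw [h0 x hx]
      exact ContinuousAlternatingMap.wedge_zero _]
  set g := c ∘ f ∘ e.symm
  set D := coordDomain e c f
  have hDo : IsOpen D := isOpen_coordDomain hf.continuous
  have hgD : ContDiffOn ℝ 1 g D := contDiffOn_coord he1 hc1 hf
  set S := e '' K
  have hS : IsCompact S := hK.image_of_continuousOn (e.continuousOn.mono hKe)
  have hSD : S ⊆ D := by
    rintro _ ⟨x, hx, rfl⟩
    refine ⟨e.map_source (hKe hx), ?_⟩
    change f (e.symm (e x)) ∈ c.source
    rw [e.left_inv (hKe hx)]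
    exact hKc hx
  have hnK : ∀ y ∈ e.target, y ∉ S → e.symm y ∉ K := fun y hy hyS hyK =>
    hyS ⟨_, hyK, e.right_inv hy⟩
  -- `χ` and `χ'` turn `g`, the test form and `ω`, known only on open subsets, into global `C¹`
  -- objects that are unchanged near `S` and `g '' S`.
  obtain ⟨χ, hχ, hχc, hχD, hχ1⟩ := exists_contDiff_cutoff hS hDo hSD
  have hgS : IsCompact (g '' S) := hS.image_of_continuousOn (hgD.continuousOn.mono hSD)
  have hgSc : g '' S ⊆ c.target := by
    rintro _ ⟨y, hy, rfl⟩
    exact c.map_source (hSD hy).2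
  obtain ⟨χ', hχ', hχc', hχD', hχ1'⟩ := exists_contDiff_cutoff hgS c.open_target hgSc
  have hφe : ContDiffOn ℝ 1 (φ.inChart e) e.target :=
    hφ.contDiffOn_inChart (r := 2) (by norm_num) he2
  have hωc : ContDiffOn ℝ 1 (ω.inChart c) c.target :=
    hω.contDiffOn_inChart (r := 2) (by norm_num) hc
  set g' := fun y => χ y • g y with hg'
  set φ' := fun y => χ y • φ.inChart e y with hφ'
  set ω' := fun z => χ' z • ω.inChart c z with hω'
  have hχ1d : ContDiff ℝ 1 χ := hχ.of_le (by exact_mod_cast le_top)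
  have hχ1d' : ContDiff ℝ 1 χ' := hχ'.of_le (by exact_mod_cast le_top)
  -- The test form is unchanged on the whole chart, since it vanishes off `S` and `χ = 1` on `S`.
  have hφ'eq : EqOn φ' (φ.inChart e) e.target := by
    intro y hy
    by_cases hyS : y ∈ S
    · simp [hφ', (hχ1 y hyS).self_of_nhds]
    · simp [hφ', inChart_eq_zero (h0 _ (hnK y hy hyS))]
  have hφ'd : ∀ y ∈ e.target, extDeriv φ' y = extDeriv (φ.inChart e) y := fun y hy =>
    (hφ'eq.eventuallyEq_of_mem (e.open_target.mem_nhds hy)).extDeriv_eq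
  have hdφ0 : ∀ y ∈ e.target, y ∉ S → extDeriv (φ.inChart e) y = 0 := by
    intro y hy hyS
    rw [← inChart_d hφ le_rfl he2 hy]
    exact inChart_eq_zero (d_eq_zero_of_notMem hK.isClosed h0 (hnK y hy hyS))
  have hφ0 : ∀ y ∉ e.target, φ' =ᶠ[𝓝 y] fun _ => 0 := by
    intro y hy
    filter_upwards [(isClosed_tsupport χ).isOpen_compl.mem_nhds fun h => hy (hχD h).1] with z hz
    simp [hφ', image_eq_zero_of_notMem_tsupport hz]
  have hcore := integral_pullback_wedge_extDeriv (volume : Measure (EuclideanSpace ℝ (Fin m)))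
    (g := g') (ω := ω') (φ := φ')
    (contDiff_smul_of_tsupport_subset hχ1d hDo hχD hgD) hχc.smul_right
    (contDiff_smul_of_tsupport_subset hχ1d' c.open_target hχD' hωc)
    (contDiff_smul_of_tsupport_subset hχ1d e.open_target
      (fun y hy => (hχD hy).1) hφe) hχc.smul_right h1 h2
    (fun i => EuclideanSpace.basisFun (Fin m) ℝ i)
  have hgeq : ∀ y ∈ S, g' =ᶠ[𝓝 y] g := fun y hy => by
    filter_upwards [hχ1 y hy] with z hz
    simp [hg', hz]
  have hωeq : ∀ y ∈ S, ω' =ᶠ[𝓝 (g y)] ω.inChart c := fun y hy => by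
    filter_upwards [hχ1' _ (mem_image_of_mem g hy)] with z hz
    simp [hω', hz]
  have hL : ∫ y in e.target, topCoeff h1 ((pullback f ω).wedge φ.d) e y =
      ∫ y, ((ω' (g' y)).compContinuousLinearMap (fderiv ℝ g' y)).wedge (extDeriv φ' y)
        (fun i => EuclideanSpace.basisFun (Fin m) ℝ (Fin.cast h1 i)) := by
    refine Eq.trans ?_ (setIntegral_eq_integral_of_forall_compl_eq_zero (s := e.target) ?_)
    · refine setIntegral_congr_fun e.open_target.measurableSet fun y hy => ?_
      simp only [topCoeff]
      rw [inChart_wedge, inChart_d hφ le_rfl he2 hy, hφ'd y hy]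
      -- On `S` the germs of `g'` and `g` agree; off `S` the two may differ, but the test factor is
      -- zero.
      by_cases hyS : y ∈ S
      · rw [inChart_pullback one_ne_zero he1 hc1 hf ω (hSD hyS), (hgeq y hyS).fderiv_eq,
          (hgeq y hyS).self_of_nhds, (hωeq y hyS).self_of_nhds]
      · simp [hdφ0 y hy hyS]
    · intro y hy
      rw [(hφ0 y hy).extDeriv_eq]
      have : extDeriv (fun _ : EuclideanSpace ℝ (Fin m) =>
          (0 : EuclideanSpace ℝ (Fin m) [⋀^Fin q]→L[ℝ] ℝ)) y = 0 := by
        ext v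
        simp [extDeriv, ContinuousAlternatingMap.alternatizeUncurryFin_apply]
      simp [this]
  have hR : ∫ y in e.target, topCoeff h2 ((pullback f ω.d).wedge φ) e y =
      ∫ y, ((extDeriv ω' (g' y)).compContinuousLinearMap (fderiv ℝ g' y)).wedge (φ' y)
        (fun i => EuclideanSpace.basisFun (Fin m) ℝ (Fin.cast h2 i)) := by
    refine Eq.trans ?_ (setIntegral_eq_integral_of_forall_compl_eq_zero (s := e.target) ?_)
    · refine setIntegral_congr_fun e.open_target.measurableSet fun y hy => ?_
      simp only [topCoeff]
      rw [inChart_wedge, hφ'eq hy]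
      by_cases hyS : y ∈ S
      · have hdc : ω.d.inChart c ((c ∘ f ∘ e.symm) y) =
            extDeriv (ω.inChart c) ((c ∘ f ∘ e.symm) y) :=
          inChart_d hω le_rfl hc (c.map_source (hSD hyS).2)
        rw [inChart_pullback one_ne_zero he1 hc1 hf ω.d (hSD hyS), (hgeq y hyS).fderiv_eq,
          (hgeq y hyS).self_of_nhds, (hωeq y hyS).extDeriv_eq, hdc]
      · simp [inChart_eq_zero (h0 _ (hnK y hy hyS))]
    · intro y hy
      simp [(hφ0 y hy).self_of_nhds]
  rw [hL, hR, hcore]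

end DiffForm

/-! ### Globalisation and uniqueness for scalar forms -/

namespace DiffForm

open Filter Topology

variable {m n : ℕ} {M : Type*} [TopologicalSpace M] [ChartedSpace (EuclideanSpace ℝ (Fin m)) M]
  {N : Type*} [TopologicalSpace N] [ChartedSpace (EuclideanSpace ℝ (Fin n)) N] {h p q : ℕ}
  [T2Space M]

omit [T2Space M] in
theorem isClass_zero {l : ℕ∞} : IsClass l (0 : DiffForm m M h) := fun _ _ =>
  contDiffOn_const.congr fun _ _ => inChart_eq_zero rfl

theorem hasCompactSupp_zero : HasCompactSupp (0 : DiffForm m M h) :=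
  HasCompactSupp.of_forall_notMem isCompact_empty fun _ _ => rfl

theorem HasCompactSupp.d {φ : DiffForm m M q} (hc : φ.HasCompactSupp) : φ.d.HasCompactSupp :=
  HasCompactSupp.of_forall_notMem hc fun _ hx =>
    d_eq_zero_of_notMem isClosed_closure (fun _ hz => HasCompactSupp.notMem hz) hx

theorem HasCompactSupp.wedge {φ : DiffForm m M q} (hc : φ.HasCompactSupp) (lam : DiffForm m M h) :
    (lam.wedge φ).HasCompactSupp :=
  HasCompactSupp.of_forall_notMem hc fun x hx => by
    unfold DiffForm.wedge
    rw [HasCompactSupp.notMem hx]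
    exact ContinuousAlternatingMap.wedge_zero _

theorem HasCompactSupp.smul {φ : DiffForm m M q} (hc : φ.HasCompactSupp) (χ : M → ℝ) :
    HasCompactSupp fun x => χ x • φ x :=
  HasCompactSupp.of_forall_notMem hc fun x hx => by
    rw [HasCompactSupp.notMem hx]
    exact smul_zero _

/-- Cutoff functions on a manifold, equal to `1` near a given point. -/
theorem exists_cutoff [IsManifold (𝓡 m) 1 M]
    {e : OpenPartialHomeomorph M (EuclideanSpace ℝ (Fin m))}
    (he : e ∈ IsManifold.maximalAtlas (𝓡 m) 1 M) {U : Set M} (hU : IsOpen U) {x : M}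
    (hxe : x ∈ e.source) (hxU : x ∈ U) :
    ∃ (χ : M → ℝ) (O K : Set M), IsOpen O ∧ x ∈ O ∧ IsCompact K ∧ K ⊆ e.source ∧ K ⊆ U ∧
      (∀ z ∈ O, χ z = 1) ∧ (∀ z ∉ K, χ z = 0) ∧
      ∀ e' ∈ atlas (EuclideanSpace ℝ (Fin m)) M, ContDiffOn ℝ 1 (χ ∘ e'.symm) e'.target := by
  obtain ⟨b, hb, hbc, hbD, hb1⟩ := exists_contDiff_cutoff (isCompact_singleton (x := e x))
    (e.isOpen_inter_preimage_symm hU) (singleton_subset_iff.2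
      ⟨e.map_source hxe, by rwa [mem_preimage, e.left_inv hxe]⟩)
  have hbt : tsupport b ⊆ e.target := fun y hy => (hbD hy).1
  have h1 : ∀ᶠ z in 𝓝 x, extendByZero e b z = 1 := by
    filter_upwards [(e.continuousAt hxe).eventually (hb1 _ rfl), e.open_source.mem_nhds hxe]
      with z hz hze
    exact (if_pos hze).trans hz
  obtain ⟨O, hO1, hO, hxO⟩ := eventually_nhds_iff.1 h1
  refine ⟨extendByZero e b, O, e.symm '' tsupport b, hO, hxO,
    isCompact_symm_image hbc.isCompact hbt, ?_, ?_, hO1, fun z hz => extendByZero_eq_zero hz,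
    fun e' he' => contDiffOn_extendByZero he (IsManifold.subset_maximalAtlas he')
      (hb.of_le (by exact_mod_cast le_top)) hbc hbt⟩
  · rintro _ ⟨y, hy, rfl⟩
    exact e.map_target (hbt hy)
  · rintro _ ⟨y, hy, rfl⟩
    exact (hbD hy).2

variable [SecondCountableTopology M] {k : ℕ∞}

/-- The exterior derivative of the pullback in the sense of distributions, for scalar forms. -/
theorem integral_pullback_wedge_d [IsManifold (𝓡 m) k M]
    [IsManifold (𝓡 n) 2 N] (hk : 2 ≤ k) (o : OrientedAtlas m k M) {f : M → N}
    (hf : ContMDiff (𝓡 m) (𝓡 n) 1 f) {ω : DiffForm n N h} (hω : ω.IsClass 1)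
    {φ : DiffForm m M q} (hφ : φ.IsClass 1) (hc : φ.HasCompactSupp)
    (h1 : h + (q + 1) = m) (h2 : h + 1 + q = m) :
    o.integral h1 ((pullback f ω).wedge φ.d) =
      (-1) ^ (h + 1) * o.integral h2 ((pullback f ω.d).wedge φ) := by
  have hk2 : (2 : WithTop ℕ∞) ≤ k := WithTop.coe_le_coe.2 hk
  have hk1 : (1 : ℕ∞) ≤ k := one_le_two.trans hk
  have : IsManifold (𝓡 m) 2 M := IsManifold.of_le hk2
  have : IsManifold (𝓡 m) 1 M := IsManifold.of_le (n := 2) one_le_two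
  have : IsManifold (𝓡 n) 1 N := IsManifold.of_le (n := 2) one_le_two
  have hw1 : ∀ {ψ : DiffForm m M q}, ψ.IsClass 1 →
      ((pullback f ω : DiffForm m M h).wedge ψ.d).IsClass 0 := fun hψ =>
    ((hω.of_le zero_le_one).pullback hf).wedge hψ.d
  have hw2 : ∀ {ψ : DiffForm m M q}, ψ.IsClass 1 →
      ((pullback f ω.d : DiffForm m M (h + 1)).wedge ψ).IsClass 0 := fun hψ =>
    (hω.d.pullback hf).wedge (hψ.of_le zero_le_one)
  have hex : ∀ x : M, _ := fun x => exists_cutoff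
    (IsManifold.maximalAtlas_subset_of_le (one_le_two.trans hk2)
      (o.mem_maximalAtlas _ (o.chart_mem x)))
    ((chartAt (EuclideanSpace ℝ (Fin n)) (f x)).open_source.preimage hf.continuous)
    (o.mem_chart_source x) (mem_chart_source _ (f x))
  choose χ O K hO hxO hK hKe hKc hχ1 hχ0 hχd using hex
  -- Induction on the number of sets `O i` needed to cover the points where `φ ≠ 0`, peeling off one
  -- cutoff at a time.
  suffices H : ∀ (s : Finset M) (φ : DiffForm m M q), φ.IsClass 1 → φ.HasCompactSupp →
      (∀ x, φ x ≠ 0 → ∃ i ∈ s, x ∈ O i) →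
      o.integral h1 ((pullback f ω).wedge φ.d) =
        (-1) ^ (h + 1) * o.integral h2 ((pullback f ω.d).wedge φ) by
    obtain ⟨s, hs⟩ := IsCompact.elim_finite_subcover hc O hO
      fun x _ => mem_iUnion.2 ⟨x, hxO x⟩
    refine H s φ hφ hc fun x hx => ?_
    simpa using hs (subset_closure hx)
  classical
  intro s
  induction s using Finset.induction_on with
  | empty =>
    intro φ hφ _ h0
    have h0' : ∀ x ∉ (∅ : Set M), φ x = 0 := fun x _ => by
      by_contra hx
      simpa using h0 x hx
    -- A point of `M` supplies the charts for the local lemma with `K = ∅`; if `M` is empty, both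
    -- integrals are empty sums.
    by_cases hM : Nonempty M
    · obtain ⟨x⟩ := hM
      exact integral_pullback_wedge_d_of_support_subset hk o hf hω hφ h1 h2 (o.chart_mem x)
        (IsManifold.chart_mem_maximalAtlas (f x)) isCompact_empty (empty_subset _)
        (empty_subset _) h0'
    · have := not_nonempty_iff.1 hM
      unfold OrientedAtlas.integral
      rw [finsum_of_isEmpty, finsum_of_isEmpty, mul_zero]
  | insert a s _ ih =>
    intro φ hφ hc h0
    set ψ₁ : DiffForm m M q := fun x => χ a x • φ x with hψ₁
    -- `ψ₂` vanishes on `O a`, where `χ a = 1`, so the remaining sets cover the points where it is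
    -- nonzero.
    set ψ₂ : DiffForm m M q := fun x => (1 - χ a x) • φ x with hψ₂
    have hψ₁c : ψ₁.IsClass 1 := hφ.smul (hχd a)
    have hψ₂c : ψ₂.IsClass 1 := hφ.smul fun e he => contDiffOn_const.sub (hχd a e he)
    have hs₁ : ψ₁.HasCompactSupp := hc.smul _
    have hs₂ : ψ₂.HasCompactSupp := hc.smul _
    have hsum : φ = fun x => ψ₁ x + ψ₂ x := by
      funext x
      simp only [hψ₁, hψ₂]
      rw [← add_smul, add_sub_cancel, one_smul]
    have e1 : o.integral h1 ((pullback f ω).wedge ψ₁.d) =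
        (-1) ^ (h + 1) * o.integral h2 ((pullback f ω.d).wedge ψ₁) :=
      integral_pullback_wedge_d_of_support_subset hk o hf hω hψ₁c h1 h2 (o.chart_mem a)
        (IsManifold.chart_mem_maximalAtlas (f a)) (hK a) (hKe a) (hKc a) fun x hx => by
          simp only [hψ₁, hχ0 a x hx]
          exact zero_smul _ _
    have e2 := ih ψ₂ hψ₂c hs₂ fun x hx => by
      have hφx : φ x ≠ 0 := fun h => hx (by simp only [hψ₂, h]; exact smul_zero _)
      obtain ⟨i, hi, hxi⟩ := h0 x hφx
      rcases Finset.mem_insert.1 hi with rfl | his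
      · exact absurd (by simp only [hψ₂, hχ1 i x hxi, sub_self]; exact zero_smul _ _) hx
      · exact ⟨i, his, hxi⟩
    have hL : (pullback f ω : DiffForm m M h).wedge φ.d = fun x =>
        (pullback f ω : DiffForm m M h).wedge ψ₁.d x +
          (pullback f ω : DiffForm m M h).wedge ψ₂.d x := by
      funext x
      have := d_add hψ₁c hψ₂c x
      rw [← hsum] at this
      simp only [DiffForm.wedge]
      rw [this]
      exact ContinuousAlternatingMap.wedge_add _ _ _
    have hR : (pullback f ω.d : DiffForm m M (h + 1)).wedge φ = fun x =>
        (pullback f ω.d : DiffForm m M (h + 1)).wedge ψ₁ x +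
          (pullback f ω.d : DiffForm m M (h + 1)).wedge ψ₂ x := by
      funext x
      simp only [DiffForm.wedge]
      rw [congrFun hsum x]
      exact ContinuousAlternatingMap.wedge_add _ _ _
    rw [hL, hR, o.integral_add hk1 h1 (hw1 hψ₁c) (hs₁.d.wedge _) (hw1 hψ₂c) (hs₂.d.wedge _),
      o.integral_add hk1 h2 (hw2 hψ₁c) (hs₁.wedge _) (hw2 hψ₂c) (hs₂.wedge _), e1, e2]
    ring

omit [T2Space M] [SecondCountableTopology M] in
theorem apply_eq_of_inChart_eq {r : WithTop ℕ∞} (hr : r ≠ 0)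
    {e : OpenPartialHomeomorph M (EuclideanSpace ℝ (Fin m))}
    (he : e ∈ IsManifold.maximalAtlas (𝓡 m) r M) {μ ν : DiffForm m M p} {x : M}
    (hx : x ∈ e.source) (h : μ.inChart e (e x) = ν.inChart e (e x)) : μ x = ν x := by
  have hEq : e.symm ∘ e =ᶠ[𝓝 x] id := by
    filter_upwards [e.open_source.mem_nhds hx] with z hz
    exact e.left_inv hz
  have hder : ∀ w : EuclideanSpace ℝ (Fin m), (mfderiv (𝓡 m) (𝓡 m) e.symm (e x)
      (mfderiv (𝓡 m) (𝓡 m) e x w) : EuclideanSpace ℝ (Fin m)) = w := by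
    intro w
    have h1 := mfderiv_comp_apply x (mdifferentiableAt_symm hr he (e.map_source hx))
      (mdifferentiableAt_chart hr he hx) w
    have h2 := hEq.mfderiv_eq (I := 𝓡 m) (I' := 𝓡 m)
    rw [mfderiv_id] at h2
    refine h1.symm.trans ?_
    exact congrArg (fun A : EuclideanSpace ℝ (Fin m) →L[ℝ] EuclideanSpace ℝ (Fin m) => A w) h2
  have key : ∀ (τ : DiffForm m M p) (v : Fin p → EuclideanSpace ℝ (Fin m)), (τ x v : ℝ) =
      τ.inChart e (e x) fun i => mfderiv (𝓡 m) (𝓡 m) e x (v i) := by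
    intro τ v
    refine (apply_congr_point τ (e.left_inv hx).symm v).trans ?_
    refine congrArg (fun u : Fin p → EuclideanSpace ℝ (Fin m) => (τ (e.symm (e x)) u : ℝ)) ?_
    funext i
    exact (hder (v i)).symm
  ext v
  exact (key μ v).trans ((congrArg (fun a => a fun i => mfderiv (𝓡 m) (𝓡 m) e x (v i)) h).trans
    (key ν v).symm)

/-- A continuous form is determined by its integrals against test forms. -/
theorem eq_of_forall_integral_wedge_eq [IsManifold (𝓡 m) k M] (o : OrientedAtlas m k M) {l : ℕ∞}
    (hlk : l + 1 ≤ k) (hm : p + q = m) {μ ν : DiffForm m M p} (hμ : μ.IsClass 0)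
    (hν : ν.IsClass 0)
    (H : ∀ φ : DiffForm m M q, φ.IsClass l → φ.HasCompactSupp →
      o.integral hm (μ.wedge φ) = o.integral hm (ν.wedge φ)) : μ = ν := by
  have hlk' : (l : WithTop ℕ∞) + 1 ≤ k := WithTop.coe_le_coe.2 hlk
  have hk1 : 1 ≤ k := le_trans (by simp) hlk
  have hk1' : (1 : WithTop ℕ∞) ≤ k := WithTop.coe_le_coe.2 hk1
  have hk0 : (k : WithTop ℕ∞) ≠ 0 := (zero_lt_one.trans_le hk1').ne'
  funext x
  set e := o.chart x with he
  have hem := o.mem_maximalAtlas e (o.chart_mem x)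
  have hxe : x ∈ e.source := o.mem_chart_source x
  have hxt : e x ∈ e.target := e.map_source hxe
  refine apply_eq_of_inChart_eq hk0 hem hxe (sub_eq_zero.1 ?_)
  refine ContinuousAlternatingMap.eq_zero_of_forall_wedge_apply_basis_eq_zero hm _ fun β => ?_
  -- With the constant form `β` fixed, only the scalar coefficient `F τ` of `τ ∧ β` matters.
  set F : DiffForm m M p → EuclideanSpace ℝ (Fin m) → ℝ := fun τ y =>
    (τ.inChart e y).wedge β (fun i => EuclideanSpace.basisFun (Fin m) ℝ (Fin.cast hm i)) with hF
  have hFc : ∀ {τ : DiffForm m M p}, τ.IsClass 0 → ContinuousOn (F τ) e.target := fun hτ =>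
    (ContinuousAlternatingMap.apply ℝ _ ℝ _).continuous.comp_continuousOn
      (ContinuousAlternatingMap.continuousOn_wedge
        (hτ.contDiffOn_inChart (r := k) (by simpa using hk1') hem).continuousOn continuousOn_const)
  have hFsub : (μ.inChart e (e x) - ν.inChart e (e x)).wedge β
      (fun i => EuclideanSpace.basisFun (Fin m) ℝ (Fin.cast hm i)) = F μ (e x) - F ν (e x) := by
    rw [sub_eq_add_neg, ← neg_one_smul ℝ (ν.inChart e (e x)), ContinuousAlternatingMap.add_wedge,
      ContinuousAlternatingMap.smul_wedge]
    simp [hF, sub_eq_add_neg]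
  rw [hFsub]
  by_contra hne
  -- Multiplying the difference by its own value `c ≠ 0` at `e x` makes it positive nearby and
  -- avoids a case split on the sign.
  set c := F μ (e x) - F ν (e x) with hc
  have hGc : ContinuousOn (fun y => (F μ y - F ν y) * c) e.target :=
    ((hFc hμ).sub (hFc hν)).mul continuousOn_const
  have hpos : {y | 0 < (F μ y - F ν y) * c} ∩ e.target ∈ 𝓝 (e x) := by
    refine inter_mem ?_ (e.open_target.mem_nhds hxt)
    exact (hGc.continuousAt (e.open_target.mem_nhds hxt)).eventually
      (lt_mem_nhds (mul_self_pos.2 hne))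
  obtain ⟨b, hbs, hbc, hb, hb01, hb1⟩ := exists_contDiff_tsupport_subset (n := l) hpos
  have hb0 : ∀ y, 0 ≤ b y := fun y => (hb01 (mem_range_self y)).1
  have hbt : tsupport b ⊆ e.target := fun y hy => (hbs hy).2
  set B : EuclideanSpace ℝ (Fin m) → EuclideanSpace ℝ (Fin m) [⋀^Fin q]→L[ℝ] ℝ :=
    fun y => b y • β with hB
  have hBs : tsupport B ⊆ tsupport b := closure_mono fun y hy h0 =>
    hy (by simp only [hB, h0, zero_smul])
  have hBc : HasCompactSupport B := hbc.smul_right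
  have hcont : ∀ {τ : DiffForm m M p}, τ.IsClass 0 → Continuous fun y => b y * F τ y := fun hτ =>
    (contDiff_smul_of_tsupport_subset (n := 0) (hb.of_le (by simp)) e.open_target hbt
      (contDiffOn_zero.2 (hFc hτ))).continuous
  have hint : ∀ {τ : DiffForm m M p}, τ.IsClass 0 → Integrable fun y => b y * F τ y := fun hτ =>
    (hcont hτ).integrable_of_hasCompactSupport hbc.mul_right
  have hφ : (ofChart e B : DiffForm m M q).IsClass l :=
    isClass_ofChart hem hlk' (hb.smul contDiff_const) hBc (hBs.trans hbt)
  have hKc : IsCompact (e.symm '' tsupport B) :=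
    isCompact_symm_image hBc.isCompact (hBs.trans hbt)
  have hKe : e.symm '' tsupport B ⊆ e.source := by
    rintro _ ⟨y, hy, rfl⟩
    exact e.map_target (hbt (hBs hy))
  have hval : ∀ {τ : DiffForm m M p}, τ.IsClass 0 →
      o.integral hm (τ.wedge (ofChart e B)) = ∫ y, b y * F τ y := by
    intro τ hτ
    rw [o.integral_eq_setIntegral_chart hk1 hm (hτ.wedge (hφ.of_le zero_le)) (o.chart_mem x)
      hKc hKe fun z hz => by
        unfold wedge
        rw [ofChart_eq_zero hz]
        exact ContinuousAlternatingMap.wedge_zero _]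
    refine Eq.trans ?_ (setIntegral_eq_integral_of_forall_compl_eq_zero (s := e.target) ?_)
    · refine setIntegral_congr_fun e.open_target.measurableSet fun y hy => ?_
      simp only [topCoeff]
      rw [inChart_wedge, inChart_ofChart hk0 hem B hy, hB,
        ContinuousAlternatingMap.wedge_smul]
      rfl
    · intro y hy
      rw [image_eq_zero_of_notMem_tsupport fun h => hy (hbt h), zero_mul]
  have hzero := H _ hφ (HasCompactSupp.of_forall_notMem hKc fun z hz => ofChart_eq_zero hz)
  rw [hval hμ, hval hν] at hzero
  -- The hypothesis says that this integral is zero, whereas the integrand is nonnegative,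
  -- continuous and nonzero at `e x`.
  have hpos' : 0 < ∫ y, (b y * F μ y - b y * F ν y) * c := by
    refine Continuous.integral_pos_of_hasCompactSupport_nonneg_nonzero (x := e x)
      (((hcont hμ).sub (hcont hν)).mul continuous_const) ?_ (fun y => ?_) ?_
    · exact (hbc.mul_right.sub hbc.mul_right).mul_right
    · by_cases hy : y ∈ tsupport b
      · have : 0 < (F μ y - F ν y) * c := (hbs hy).1
        have := mul_nonneg (hb0 y) this.le
        change 0 ≤ (b y * F μ y - b y * F ν y) * c
        linarith
      · simp [image_eq_zero_of_notMem_tsupport hy]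
    · rw [hb1, one_mul, one_mul]
      exact (mul_self_pos.2 hne).ne'
  rw [MeasureTheory.integral_mul_const, integral_sub (hint hμ) (hint hν), hzero, sub_self,
    zero_mul] at hpos'
  exact lt_irrefl _ hpos'

end DiffForm

/-! ### Matrices of forms -/

namespace MatForm

variable {m n : ℕ} {M : Type*} [TopologicalSpace M] [T2Space M] [SecondCountableTopology M]
  [ChartedSpace (EuclideanSpace ℝ (Fin m)) M]
  {N : Type*} [TopologicalSpace N] [ChartedSpace (EuclideanSpace ℝ (Fin n)) N]
  {L h q : ℕ} {k : ℕ∞}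

theorem integral_wedge_apply [IsManifold (𝓡 m) k M] (o : OrientedAtlas m k M) (hk : 1 ≤ k)
    (hm : h + q = m) {lam : MatForm m M L h} {φ : MatForm m M L q} (hlam : lam.IsClass 0)
    (hφ : φ.IsClass 0) (hc : φ.HasCompactSupp) (i j : Fin L) :
    integral o hm (lam.wedge φ) i j = ∑ r, o.integral hm ((lam i r).wedge (φ r j)) :=
  o.integral_sum hk hm Finset.univ (fun r => (hlam i r).wedge (hφ r j)) fun r => (hc r j).wedge _

/-- The pullback of a `C^1` form by a `C^1` map has the expected distributional derivative. -/
theorem isDED_pullback [IsManifold (𝓡 m) k M] [IsManifold (𝓡 n) 2 N] (hk : 2 ≤ k)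
    (o : OrientedAtlas m k M) {f : M → N} (hf : ContMDiff (𝓡 m) (𝓡 n) 1 f)
    {ω : MatForm n N L h} (hω : ω.IsClass 1) {l : ℕ∞} (hl : 1 ≤ l) :
    IsDED o l (pullback (m := m) f ω) (pullback f ω.d) := by
  have hk2 : (2 : WithTop ℕ∞) ≤ k := WithTop.coe_le_coe.2 hk
  have hk1 : (1 : ℕ∞) ≤ k := one_le_two.trans hk
  have : IsManifold (𝓡 m) 2 M := IsManifold.of_le hk2
  have : IsManifold (𝓡 m) 1 M := IsManifold.of_le (n := 2) one_le_two
  have : IsManifold (𝓡 n) 1 N := IsManifold.of_le (n := 2) one_le_two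
  have hleft : (pullback (m := m) (M := M) f ω).IsClass 0 := fun i j =>
    ((hω i j).of_le zero_le_one).pullback hf
  have hright : (pullback (m := m) (M := M) f ω.d).IsClass 0 := fun i j =>
    ((hω i j).d).pullback hf
  refine ⟨hleft, hright, fun q hq φ hφ hc => ?_⟩
  have hφ1 : ∀ i j, (φ i j).IsClass 1 := fun i j => (hφ i j).of_le hl
  have hd : φ.d.IsClass 0 := fun i j => (hφ1 i j).d
  have hdc : φ.d.HasCompactSupp := fun i j => (hc i j).d
  ext i j
  refine (integral_wedge_apply o hk1 _ hleft hd hdc i j).trans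
    (Eq.trans ?_ (congrArg ((-1) ^ (h + 1) * ·) (integral_wedge_apply o hk1 _ hright
      (fun i j => (hφ1 i j).of_le zero_le_one) hc i j)).symm)
  rw [Finset.mul_sum]
  exact Finset.sum_congr rfl fun r _ => DiffForm.integral_pullback_wedge_d hk o hf (hω i r)
    (hφ1 r j) (hc r j) _ _

/-- Uniqueness of the distributional exterior derivative. -/
theorem IsDED.unique [IsManifold (𝓡 m) k M] {o : OrientedAtlas m k M} {l : ℕ∞}
    (hlk : l + 1 ≤ k) (hh : h + 1 ≤ m) {lam : MatForm m M L h} {μ ν : MatForm m M L (h + 1)}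
    (hμ : IsDED o l lam μ) (hν : IsDED o l lam ν) : μ = ν := by
  classical
  have hk1 : 1 ≤ k := le_trans (by simp) hlk
  obtain ⟨q, rfl⟩ := Nat.exists_eq_add_of_le hh
  ext1 i r
  refine DiffForm.eq_of_forall_integral_wedge_eq (q := q) o hlk rfl (hμ.continuous_right i r)
    (hν.continuous_right i r) fun ψ hψ hψc => ?_
  -- With `ψ` in position `(r, r)` only, entry `(i, r)` of `τ ∧ φ` is exactly `τ i r ∧ ψ`.
  let φ : MatForm (h + 1 + q) M L q := fun a b => if a = r ∧ b = r then ψ else 0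
  have hφ : φ.IsClass l := fun a b => by
    by_cases hab : a = r ∧ b = r
    · simpa only [φ, if_pos hab] using hψ
    · simpa only [φ, if_neg hab] using DiffForm.isClass_zero
  have hφc : φ.HasCompactSupp := fun a b => by
    by_cases hab : a = r ∧ b = r
    · simpa only [φ, if_pos hab] using hψc
    · simpa only [φ, if_neg hab] using DiffForm.hasCompactSupp_zero
  have hsum : ∀ {τ : MatForm (h + 1 + q) M L (h + 1)}, τ.IsClass 0 →
      integral o rfl (τ.wedge φ) i r = o.integral rfl ((τ i r).wedge ψ) := by
    intro τ hτ
    rw [integral_wedge_apply o hk1 rfl hτ (fun a b => (hφ a b).of_le zero_le) hφc,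
      Finset.sum_eq_single r]
    · simp [φ]
    · intro s _ hs
      have h0 : (τ i s).wedge (φ s r) = fun _ => 0 := by
        funext x
        simp only [φ, hs, false_and, if_false]
        exact ContinuousAlternatingMap.wedge_zero _
      rw [h0]
      -- The zero form is treated as an empty sum.
      simpa using o.integral_sum hk1 rfl (∅ : Finset (Fin L)) (fun s => hτ i s |>.wedge (hψ.of_le zero_le))
        fun s => hψc.wedge _
    · simp
  have h1 := hμ.integral_eq q (by omega) φ hφ hφc
  rw [hν.integral_eq q (by omega) φ hφ hφc] at h1
  have h2 := congrFun (congrFun (smul_right_injective _ (pow_ne_zero (h + 1)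
    (neg_ne_zero.2 (one_ne_zero (α := ℝ)))) h1) i) r
  rw [← hsum hμ.continuous_right, ← hsum hν.continuous_right]
  exact h2.symm

end MatForm

end

theorem proposition3p6 {m n L h : ℕ} {k : ℕ∞} (hk : 2 ≤ k)
    {M : Type*} [TopologicalSpace M] [T2Space M] [SecondCountableTopology M]
    [ChartedSpace (EuclideanSpace ℝ (Fin m)) M] [IsManifold (𝓡 m) k M]
    (o : OrientedAtlas m k M)
    {N : Type*} [TopologicalSpace N] [T2Space N] [SecondCountableTopology N]
    [ChartedSpace (EuclideanSpace ℝ (Fin n)) N] [IsManifold (𝓡 n) 2 N]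
    (f : M → N) (hf : ContMDiff (𝓡 m) (𝓡 n) 1 f)
    (hh : h + 1 ≤ m) (ω : MatForm n N L h) (hω : ω.IsClass 1) :
    (∀ l : ℕ∞, 1 ≤ l → l ≤ k →
      MatForm.IsDED o l (MatForm.pullback (m := m) f ω) (MatForm.pullback f ω.d)) ∧
    (∀ l : ℕ∞, 1 ≤ l → l + 1 ≤ k → ∀ μ : MatForm m M L (h + 1),
      MatForm.IsDED o l (MatForm.pullback f ω) μ → μ = MatForm.pullback f ω.d) :=
  ⟨fun _ hl _ => MatForm.isDED_pullback hk o hf hω hl,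
    fun _ hl hlk _ hμ => hμ.unique hlk hh (MatForm.isDED_pullback hk o hf hω hl)⟩
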